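/- **Setting.** Let $\mathsf{BA}$ be the category of Boolean algebras and homomorphisms and $\mathsf{Stone}$ the category of Stone spaces and continuous maps. Let $\mathsf{uf}:\mathsf{BA}^{op}\to\mathsf{Stone}$ (ultrafilters, inverse image) and $\mathsf{clp}:\mathsf{Stone}^{op}\to\mathsf{BA}$ (clopen sets, inverse image) be the functors of Stone duality. For $b$ in a Boolean algebra $B$ put $\beta(b)=\{p\in\mathsf{uf}B\mid b\in p\}$. Finitary propositional formulae are given by $\pi::=v\mid\top\mid\neg\pi\mid\pi\wedge\pi$ with $v$ in a countable set $V$ of variables, and *finitary one-step axioms* by $\phi::=\Box\pi\mid\top\mid\neg\phi\mid\phi\wedge\phi$. Let $\mathrm{Ax}$ be a set of finitary one-step axioms. An assignment $\theta:V\to B$ gives values $\hat\theta(\pi)\in B$. It interprets a one-step axiom $\phi$ as an element $\overline\theta(\phi)$ of the free Boolean algebra on $\{\Box b\mid b\in B\}$, with $\overline\theta(\Box\pi)=\Box\hat\theta(\pi)$ and the Boolean connectives interpreted as usual. It also interprets $\phi$ as a set $\theta^t(\phi)\subseteq\mathcal P B$, with $\theta^t(\Box\pi)=\{W\mid\hat\theta(\pi)\in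 W\}$ and the connectives interpreted as set operations. A set $W\subseteq B$ is an *$\mathrm{Ax}$-subset* if $W\in\theta^t(\phi)$ for all $\phi\in\mathrm{Ax}$ and all $\theta:V\to B$. - $\mathsf N_{\mathrm{Ax}}:\mathsf{BA}\to\mathsf{BA}$ sends $B$ to the free Boolean algebra on $\{\Box b\mid b\in B\}$ modulo the congruence generated by $\overline\theta(\phi)\sim1$ ($\phi\in\mathrm{Ax}$, $\theta:V\to B$), and a homomorphism $h$ to $\Box b\mapsto\Box h(b)$. - For a Stone space $X$, the $\mathsf D$-hyperspace is $\mathcal P(\mathsf{clp}X)$ with the topology generated by the sets $\{W\mid a\in W\}$ and $\{W\mid X\setminus a\notin W\}$, $a\in\mathsf{clp}X$. $\mathsf D_{\mathrm{Ax}}:\mathsf{Stone}\to\mathsf{Stone}$ sends $X$ to its closed subspace of $\mathrm{Ax}$-subsets of $\mathsf{clp}X$, and $f:X\to X'$ to $W\mapsto\{a'\in\mathsf{clp}X'\mid f^{-1}(a')\in W\}$. **Theorem.** For every set $\mathrm{Ax}$ of finitary one-step axioms, $\mathsf N_{\mathrm{Ax}}$ and $\mathsf D_{\mathrm{Ax}}$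 are Stone-duals: $\mathsf{uf}\circ\mathsf N_{\mathrm{Ax}}\cong\mathsf D_{\mathrm{Ax}}\circ\mathsf{uf}$ and $\mathsf N_{\mathrm{Ax}}\circ\mathsf{clp}\cong\mathsf{clp}\circ\mathsf D_{\mathrm{Ax}}$, naturally. The first isomorphism $\xi$ can be chosen so that $\beta(b)\in\xi_B(p)\iff\Box b\in p$ for $p\in\mathsf{uf}(\mathsf N_{\mathrm{Ax}}B)$ and $b\in B$. Hence $\mathsf{Alg}(\mathsf N_{\mathrm{Ax}})\equiv^{op}\mathsf{Coalg}(\mathsf D_{\mathrm{Ax}})$; more precisely, the contravariant functor $(B,\alpha)\mapsto(\mathsf{uf}B,\ \xi_B\circ\mathsf{uf}(\alpha))$, $h\mapsto\mathsf{uf}(h)$, is a dual equivalence. **The case $\mathrm{Ax}=\varnothing$ (Došen duality).** Let $\mathsf{NA}$ be the category of neighborhood algebras $(B,\boxdot)$ ($B$ a Boolean algebra, $\boxdot:B\to B$ any function) and $\boxdot$-preserving homomorphisms. Let $\mathsf{DNF}$ be the category of descriptive neighborhood frames. Its objects are triples $(X,N,A)$ with $N:X\to\mathcal P\mathcal P X$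 and $A$ a Boolean subalgebra of $\mathcal PX$ such that: - $\{x\mid a\in N(x)\}\in A$ for all $a\in A$; - $N(x)\subseteq A$ for all $x\in X$; - distinct points are separated by members of $A$; - each subfamily of $A$ with the finite intersection property has nonempty intersection. Its morphisms $(X,N,A)\to(X',N',A')$ are maps $f:X\to X'$ such that for all $a'\in A'$ one has $f^{-1}(a')\in A$, and $a'\in N'(f(x))\iff f^{-1}(a')\in N(x)$ for all $x\in X$. Then $(B,\alpha)\mapsto(B,\,b\mapsto\alpha(\Box b))$ is an isomorphism of categories $\mathsf{Alg}(\mathsf N_\varnothing)\cong\mathsf{NA}$, and $(X,\gamma)\mapsto(X,\gamma,\mathsf{clp}X)$ is an isomorphism of categories $\mathsf{Coalg}(\mathsf D_\varnothing)\cong\mathsf{DNF}$. The functor sending $(B,\boxdot)$ to $(\mathsf{uf}B,\ p\mapsto\{\beta(b)\mid\boxdot b\in p\},\ \{\beta(b)\mid b\in B\})$ and $h$ to $h^{-1}$ is a dual equivalence $\mathsf{NA}\equiv^{op}\mathsf{DNF}$. Up to natural isomorphism, it corresponds under these two isomorphisms of categories to the dual equivalence of the Theorem for $\mathrm{Ax}=\varnothing$.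 **The case $\mathrm{Ax}=\{(\mathsf N),(\mathsf C)\}$ (Jónsson–Tarski duality).** Here $(\mathsf N)$ is $\Box\top$ and $(\mathsf C)$ is $\Box v\wedge\Box v'\leftrightarrow\Box(v\wedge v')$. Let $\mathsf{MA}$ be the full subcategory of $\mathsf{NA}$ of modal algebras ($\boxdot$ preserves finite meets). Let $\mathsf{DKF}$ be the category of descriptive Kripke frames and continuous bounded morphisms; a descriptive Kripke frame is a Stone space $X$ with a relation $R$ such that each $R[x]$ is closed and $\{x\mid R[x]\cap a\neq\varnothing\}$ is clopen for each clopen $a$. Then $(B,\alpha)\mapsto(B,\,b\mapsto\alpha(\Box b))$ is an isomorphism of categories $\mathsf{Alg}(\mathsf N_{\mathrm{Ax}})\cong\mathsf{MA}$, and $(X,R)\mapsto(X,\ x\mapsto\{a\in\mathsf{clp}X\mid R[x]\subseteq a\})$ is an isomorphism of categories $\mathsf{DKF}\cong\mathsf{Coalg}(\mathsf D_{\mathrm{Ax}})$. The functor sending $(B,\boxdot)$ to $\mathsf{uf}B$ with $p\,R\,q\iff\{a\mid\boxdot a\in p\}\subseteq q$, and $h$ to $h^{-1}$, is a dual equivalence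 $\mathsf{MA}\equiv^{op}\mathsf{DKF}$. Up to natural isomorphism, it corresponds under these two isomorphisms of categories to the dual equivalence of the Theorem for $\mathrm{Ax}=\{(\mathsf N),(\mathsf C)\}$. -/

import Mathlib

open CategoryTheory Opposite TopologicalSpace

universe u v

namespace OneStepDuality

/-! ### Free Boolean algebras and quotients by generated congruences -/

/-- The equational axioms of Boolean algebras. -/
structure BoolEqs (α : Type u) [Max α] [Min α] [Compl α] [Top α] [Bot α] : Prop where
  sup_comm : ∀ a b : α, a ⊔ b = b ⊔ a
  sup_assoc : ∀ a b c : α, a ⊔ b ⊔ c = a ⊔ (b ⊔ c)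
  inf_comm : ∀ a b : α, a ⊓ b = b ⊓ a
  inf_assoc : ∀ a b c : α, a ⊓ b ⊓ c = a ⊓ (b ⊓ c)
  sup_inf_self : ∀ a b : α, a ⊔ a ⊓ b = a
  inf_sup_self : ∀ a b : α, a ⊓ (a ⊔ b) = a
  sup_inf_left : ∀ a b c : α, a ⊔ b ⊓ c = (a ⊔ b) ⊓ (a ⊔ c)
  inf_top : ∀ a : α, a ⊓ ⊤ = a
  sup_bot : ∀ a : α, a ⊔ ⊥ = a
  inf_compl : ∀ a : α, a ⊓ aᶜ = ⊥
  sup_compl : ∀ a : α, a ⊔ aᶜ = ⊤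

/-- A Boolean algebra from its equational axioms; `a ≤ b` means `a ⊔ b = b`. -/
abbrev BoolEqs.toBooleanAlgebra {α : Type u} [Max α] [Min α] [Compl α] [Top α] [Bot α]
    (h : BoolEqs α) : BooleanAlgebra α where
  __ := Lattice.mk' h.sup_comm h.sup_assoc h.inf_comm h.inf_assoc h.sup_inf_self h.inf_sup_self
  sup := max
  inf := min
  compl := compl
  top := ⊤
  bot := ⊥
  le_sup_inf a b c := by
    change _ ⊔ _ = _
    rw [← h.sup_inf_left]
    have := h.sup_inf_self (a ⊔ b ⊓ c) ⊤
    rwa [h.inf_top] at this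
  inf_compl_le_bot a := by
    change _ ⊔ _ = _
    rw [h.inf_compl, h.sup_bot]
  top_le_sup_compl a := by
    change _ ⊔ _ = _
    rw [h.sup_compl, h.sup_comm]
    have := h.sup_inf_self (⊤ : α) ⊤
    rwa [h.inf_top] at this
  le_top a := by
    change a ⊔ ⊤ = ⊤
    have := h.sup_inf_self (⊤ : α) a
    rwa [h.inf_comm, h.inf_top, h.sup_comm] at this
  bot_le a := by
    change ⊥ ⊔ a = a
    rw [h.sup_comm, h.sup_bot]

/-- Boolean terms over a set of generators. -/
inductive BATerm (G : Type u) : Type u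
  | gen : G → BATerm G
  | top : BATerm G
  | bot : BATerm G
  | compl : BATerm G → BATerm G
  | inf : BATerm G → BATerm G → BATerm G
  | sup : BATerm G → BATerm G → BATerm G

/-- Provable equality of Boolean terms in the equational theory of Boolean algebras. -/
inductive BATerm.Eqv {G : Type u} : BATerm G → BATerm G → Prop
  | refl (a) : Eqv a a
  | symm {a b} : Eqv a b → Eqv b a
  | trans {a b c} : Eqv a b → Eqv b c → Eqv a c
  | compl_congr {a b} : Eqv a b → Eqv (compl a) (compl b)
  | inf_congr {a b c d} : Eqv a b → Eqv c d → Eqv (inf a c) (inf b d)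
  | sup_congr {a b c d} : Eqv a b → Eqv c d → Eqv (sup a c) (sup b d)
  | sup_comm (a b) : Eqv (sup a b) (sup b a)
  | sup_assoc (a b c) : Eqv (sup (sup a b) c) (sup a (sup b c))
  | inf_comm (a b) : Eqv (inf a b) (inf b a)
  | inf_assoc (a b c) : Eqv (inf (inf a b) c) (inf a (inf b c))
  | sup_inf_self (a b) : Eqv (sup a (inf a b)) a
  | inf_sup_self (a b) : Eqv (inf a (sup a b)) a
  | sup_inf_left (a b c) : Eqv (sup a (inf b c)) (inf (sup a b) (sup a c))
  | inf_top (a) : Eqv (inf a top) a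
  | sup_bot (a) : Eqv (sup a bot) a
  | inf_compl (a) : Eqv (inf a (compl a)) bot
  | sup_compl (a) : Eqv (sup a (compl a)) top

instance BATerm.setoid (G : Type u) : Setoid (BATerm G) :=
  ⟨BATerm.Eqv, BATerm.Eqv.refl, BATerm.Eqv.symm, BATerm.Eqv.trans⟩

/-- The free Boolean algebra on a set `G` of generators. -/
def FreeBA (G : Type u) : Type u := Quotient (BATerm.setoid G)

namespace FreeBA

variable {G : Type u}

/-- The class of a term. -/
def ofTerm (a : BATerm G) : FreeBA G := Quotient.mk _ a

/-- The generator belonging to `g`. -/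
def gen (g : G) : FreeBA G := ofTerm (BATerm.gen g)

section Operations

@[reducible] def maxInst : Max (FreeBA G) :=
  ⟨Quotient.map₂ BATerm.sup fun _ _ h _ _ h' => h.sup_congr h'⟩
@[reducible] def minInst : Min (FreeBA G) :=
  ⟨Quotient.map₂ BATerm.inf fun _ _ h _ _ h' => h.inf_congr h'⟩
@[reducible] def complInst : Compl (FreeBA G) :=
  ⟨Quotient.map BATerm.compl fun _ _ h => h.compl_congr⟩
@[reducible] def topInst : Top (FreeBA G) := ⟨ofTerm BATerm.top⟩
@[reducible] def botInst : Bot (FreeBA G) := ⟨ofTerm BATerm.bot⟩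

attribute [local instance] maxInst minInst complInst topInst botInst

theorem boolEqs (G : Type u) : BoolEqs (FreeBA G) where
  sup_comm := by rintro ⟨a⟩ ⟨b⟩; exact Quotient.sound (.sup_comm a b)
  sup_assoc := by rintro ⟨a⟩ ⟨b⟩ ⟨c⟩; exact Quotient.sound (.sup_assoc a b c)
  inf_comm := by rintro ⟨a⟩ ⟨b⟩; exact Quotient.sound (.inf_comm a b)
  inf_assoc := by rintro ⟨a⟩ ⟨b⟩ ⟨c⟩; exact Quotient.sound (.inf_assoc a b c)
  sup_inf_self := by rintro ⟨a⟩ ⟨b⟩; exact Quotient.sound (.sup_inf_self a b)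
  inf_sup_self := by rintro ⟨a⟩ ⟨b⟩; exact Quotient.sound (.inf_sup_self a b)
  sup_inf_left := by rintro ⟨a⟩ ⟨b⟩ ⟨c⟩; exact Quotient.sound (.sup_inf_left a b c)
  inf_top := by rintro ⟨a⟩; exact Quotient.sound (.inf_top a)
  sup_bot := by rintro ⟨a⟩; exact Quotient.sound (.sup_bot a)
  inf_compl := by rintro ⟨a⟩; exact Quotient.sound (.inf_compl a)
  sup_compl := by rintro ⟨a⟩; exact Quotient.sound (.sup_compl a)

instance instBooleanAlgebra : BooleanAlgebra (FreeBA G) := (boolEqs G).toBooleanAlgebra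

end Operations

variable {B : Type v} [BooleanAlgebra B]

/-- The value of a Boolean term under an interpretation of the generators. -/
def termVal (f : G → B) : BATerm G → B
  | .gen g => f g
  | .top => ⊤
  | .bot => ⊥
  | .compl a => (termVal f a)ᶜ
  | .inf a b => termVal f a ⊓ termVal f b
  | .sup a b => termVal f a ⊔ termVal f b

theorem termVal_eq (f : G → B) {a b : BATerm G} (h : a.Eqv b) :
    termVal f a = termVal f b := by
  induction h with
  | refl => rfl
  | symm _ ih => exact ih.symm
  | trans _ _ ih ih' => exact ih.trans ih'
  | compl_congr _ ih => simp only [termVal, ih]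
  | inf_congr _ _ ih ih' => simp only [termVal, ih, ih']
  | sup_congr _ _ ih ih' => simp only [termVal, ih, ih']
  | sup_comm => exact _root_.sup_comm _ _
  | sup_assoc => exact _root_.sup_assoc _ _ _
  | inf_comm => exact _root_.inf_comm _ _
  | inf_assoc => exact _root_.inf_assoc _ _ _
  | sup_inf_self => exact _root_.sup_inf_self
  | inf_sup_self => exact _root_.inf_sup_self
  | sup_inf_left => exact _root_.sup_inf_left _ _ _
  | inf_top => exact _root_.inf_top_eq _
  | sup_bot => exact _root_.sup_bot_eq _
  | inf_compl => exact inf_compl_self _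
  | sup_compl => exact sup_compl_eq_top

/-- The universal property: a map on generators extends to a homomorphism. -/
def lift (f : G → B) : BoundedLatticeHom (FreeBA G) B where
  toFun := Quotient.lift (termVal f) fun _ _ h => termVal_eq f h
  map_sup' := by rintro ⟨a⟩ ⟨b⟩; rfl
  map_inf' := by rintro ⟨a⟩ ⟨b⟩; rfl
  map_top' := rfl
  map_bot' := rfl

theorem lift_gen (f : G → B) (g : G) : lift f (gen g) = f g := rfl

/-- A homomorphism on a free Boolean algebra is determined by its values on generators. -/
theorem hom_ext {f g : BoundedLatticeHom (FreeBA G) B} (h : ∀ x, f (gen x) = g (gen x)) :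
    f = g := by
  apply DFunLike.ext
  rintro ⟨a⟩
  change f (ofTerm a) = g (ofTerm a)
  induction a with
  | gen x => exact h x
  | top => exact (map_top f).trans (map_top g).symm
  | bot => exact (map_bot f).trans (map_bot g).symm
  | compl a ih =>
    change f (ofTerm a)ᶜ = g (ofTerm a)ᶜ
    rw [map_compl', map_compl', ih]
  | inf a b iha ihb =>
    change f (ofTerm a ⊓ ofTerm b) = g (ofTerm a ⊓ ofTerm b)
    rw [map_inf, map_inf, iha, ihb]
  | sup a b iha ihb =>
    change f (ofTerm a ⊔ ofTerm b) = g (ofTerm a ⊔ ofTerm b)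
    rw [map_sup, map_sup, iha, ihb]

end FreeBA

/-- The congruence on a Boolean algebra generated by a relation `R`. -/
inductive BACon {B : Type u} [BooleanAlgebra B] (R : B → B → Prop) : B → B → Prop
  | of {a b} : R a b → BACon R a b
  | refl (a) : BACon R a a
  | symm {a b} : BACon R a b → BACon R b a
  | trans {a b c} : BACon R a b → BACon R b c → BACon R a c
  | compl {a b} : BACon R a b → BACon R aᶜ bᶜ
  | inf {a b c d} : BACon R a b → BACon R c d → BACon R (a ⊓ c) (b ⊓ d)
  | sup {a b c d} : BACon R a b → BACon R c d → BACon R (a ⊔ c) (b ⊔ d)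

/-- The quotient of a Boolean algebra by the congruence generated by `R`. -/
def BAQuot {B : Type u} [BooleanAlgebra B] (R : B → B → Prop) : Type u :=
  Quotient (⟨BACon R, .refl, .symm, .trans⟩ : Setoid B)

namespace BAQuot

variable {B : Type u} [BooleanAlgebra B] {R : B → B → Prop}

/-- The class of an element. -/
def cls (R : B → B → Prop) (b : B) : BAQuot R := Quotient.mk _ b

theorem cls_eq {a b : B} (h : BACon R a b) : cls R a = cls R b := Quotient.sound h

section Operations

@[reducible] def maxInst : Max (BAQuot R) :=
  ⟨Quotient.map₂ (· ⊔ ·) fun _ _ h _ _ h' => BACon.sup h h'⟩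
@[reducible] def minInst : Min (BAQuot R) :=
  ⟨Quotient.map₂ (· ⊓ ·) fun _ _ h _ _ h' => BACon.inf h h'⟩
@[reducible] def complInst : Compl (BAQuot R) :=
  ⟨Quotient.map compl fun _ _ h => BACon.compl h⟩
@[reducible] def topInst : Top (BAQuot R) := ⟨cls R ⊤⟩
@[reducible] def botInst : Bot (BAQuot R) := ⟨cls R ⊥⟩

attribute [local instance] maxInst minInst complInst topInst botInst

theorem boolEqs (R : B → B → Prop) : BoolEqs (BAQuot R) where
  sup_comm := by rintro ⟨a⟩ ⟨b⟩; exact congrArg (cls R) (sup_comm a b)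
  sup_assoc := by rintro ⟨a⟩ ⟨b⟩ ⟨c⟩; exact congrArg (cls R) (sup_assoc a b c)
  inf_comm := by rintro ⟨a⟩ ⟨b⟩; exact congrArg (cls R) (inf_comm a b)
  inf_assoc := by rintro ⟨a⟩ ⟨b⟩ ⟨c⟩; exact congrArg (cls R) (inf_assoc a b c)
  sup_inf_self := by rintro ⟨a⟩ ⟨b⟩; exact congrArg (cls R) (sup_inf_self (a := a) (b := b))
  inf_sup_self := by rintro ⟨a⟩ ⟨b⟩; exact congrArg (cls R) (inf_sup_self (a := a) (b := b))
  sup_inf_left := by rintro ⟨a⟩ ⟨b⟩ ⟨c⟩; exact congrArg (cls R) (sup_inf_left a b c)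
  inf_top := by rintro ⟨a⟩; exact congrArg (cls R) (inf_top_eq a)
  sup_bot := by rintro ⟨a⟩; exact congrArg (cls R) (sup_bot_eq a)
  inf_compl := by rintro ⟨a⟩; exact congrArg (cls R) (inf_compl_self a)
  sup_compl := by rintro ⟨a⟩; exact congrArg (cls R) (sup_compl_eq_top (x := a))

instance instBooleanAlgebra : BooleanAlgebra (BAQuot R) := (boolEqs R).toBooleanAlgebra

end Operations

/-- The quotient homomorphism. -/
def mk (R : B → B → Prop) : BoundedLatticeHom B (BAQuot R) where
  toFun := cls R
  map_sup' _ _ := rfl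
  map_inf' _ _ := rfl
  map_top' := rfl
  map_bot' := rfl

variable {C : Type v} [BooleanAlgebra C]

theorem con_le_ker (f : BoundedLatticeHom B C) (hf : ∀ a b, R a b → f a = f b) {a b : B}
    (h : BACon R a b) : f a = f b := by
  induction h with
  | of h => exact hf _ _ h
  | refl => rfl
  | symm _ ih => exact ih.symm
  | trans _ _ ih ih' => exact ih.trans ih'
  | compl _ ih => rw [map_compl', map_compl', ih]
  | inf _ _ ih ih' => rw [map_inf, map_inf, ih, ih']
  | sup _ _ ih ih' => rw [map_sup, map_sup, ih, ih']

/-- A homomorphism that respects the generating relation factors through the quotient. -/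
def lift (f : BoundedLatticeHom B C) (hf : ∀ a b, R a b → f a = f b) :
    BoundedLatticeHom (BAQuot R) C where
  toFun := Quotient.lift f fun _ _ h => con_le_ker f hf h
  map_sup' := by rintro ⟨a⟩ ⟨b⟩; exact map_sup f a b
  map_inf' := by rintro ⟨a⟩ ⟨b⟩; exact map_inf f a b
  map_top' := map_top f
  map_bot' := map_bot f

theorem hom_ext {f g : BoundedLatticeHom (BAQuot R) C} (h : f.comp (mk R) = g.comp (mk R)) :
    f = g := by
  apply DFunLike.ext
  rintro ⟨a⟩
  exact DFunLike.congr_fun h a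

end BAQuot

/-! ### Finitary one-step axioms -/

/-- Finitary propositional formulae over the countable set of variables `ℕ`. -/
inductive PForm : Type
  | var : ℕ → PForm
  | top : PForm
  | neg : PForm → PForm
  | and : PForm → PForm → PForm

/-- Finitary one-step axioms: `φ ::= □π | ⊤ | ¬φ | φ ∧ φ` with `π` propositional. -/
inductive OneStep : Type
  | box : PForm → OneStep
  | top : OneStep
  | neg : OneStep → OneStep
  | and : OneStep → OneStep → OneStep

/-- The value of a propositional formula in a Boolean algebra under an assignment. -/
def PForm.eval {B : Type u} [BooleanAlgebra B] (θ : ℕ → B) : PForm → B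
  | .var n => θ n
  | .top => ⊤
  | .neg π => (π.eval θ)ᶜ
  | .and π ρ => π.eval θ ⊓ ρ.eval θ

namespace OneStep

variable {B : Type u} [BooleanAlgebra B]

/-- The interpretation of a one-step axiom in the free Boolean algebra on `{□b | b ∈ B}`, where
`□b` is the generator `FreeBA.gen b`. -/
def interp (θ : ℕ → B) : OneStep → FreeBA B
  | .box π => FreeBA.gen (π.eval θ)
  | .top => ⊤
  | .neg φ => (φ.interp θ)ᶜ
  | .and φ ψ => φ.interp θ ⊓ ψ.interp θ

/-- The set of subsets of `B` that satisfy a one-step axiom under an assignment. -/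
def sat (θ : ℕ → B) : OneStep → Set (Set B)
  | .box π => {W | π.eval θ ∈ W}
  | .top => Set.univ
  | .neg φ => (φ.sat θ)ᶜ
  | .and φ ψ => φ.sat θ ∩ ψ.sat θ

/-- `φ ↔ ψ` as an abbreviation, `¬(φ ∧ ¬ψ) ∧ ¬(ψ ∧ ¬φ)`. -/
def iff (φ ψ : OneStep) : OneStep :=
  .and (.neg (.and φ (.neg ψ))) (.neg (.and ψ (.neg φ)))

/-- The axiom (N): `□⊤`. -/
def axN : OneStep := .box .top

/-- The axiom (C): `□v ∧ □v₁ ↔ □(v ∧ v₁)`. -/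
def axC : OneStep :=
  iff (.and (.box (.var 0)) (.box (.var 1))) (.box (.and (.var 0) (.var 1)))

end OneStep

/-- `W ⊆ B` is an `Ax`-subset if it satisfies every axiom in `Ax` under every assignment. -/
def IsAxSubset (Ax : Set OneStep) {B : Type u} [BooleanAlgebra B] (W : Set B) : Prop :=
  ∀ φ ∈ Ax, ∀ θ : ℕ → B, W ∈ φ.sat θ

section Naturality

variable {B : Type u} {C : Type v} [BooleanAlgebra B] [BooleanAlgebra C]

theorem PForm.map_eval (h : BoundedLatticeHom B C) (θ : ℕ → B) (π : PForm) :
    h (π.eval θ) = π.eval (fun n => h (θ n)) := by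
  induction π with
  | var n => rfl
  | top => exact map_top h
  | neg π ih => simp only [eval, map_compl', ih]
  | and π ρ ih ih' => simp only [eval, map_inf, ih, ih']

theorem OneStep.lift_interp (h : BoundedLatticeHom B C) (θ : ℕ → B) (φ : OneStep) :
    FreeBA.lift (fun b => FreeBA.gen (h b)) (φ.interp θ) = φ.interp (fun n => h (θ n)) := by
  induction φ with
  | box π => simp only [interp, FreeBA.lift_gen, PForm.map_eval]
  | top => exact map_top _
  | neg φ ih => simp only [interp, map_compl', ih]
  | and φ ψ ih ih' => simp only [interp, map_inf, ih, ih']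

theorem OneStep.preimage_mem_sat (h : BoundedLatticeHom B C) (θ : ℕ → B) (φ : OneStep)
    (W : Set C) : h ⁻¹' W ∈ φ.sat θ ↔ W ∈ φ.sat (fun n => h (θ n)) := by
  induction φ with
  | box π => simp only [sat, Set.mem_ofPred_eq, Set.mem_preimage, PForm.map_eval]
  | top => exact Iff.rfl
  | neg φ ih => simp only [sat, Set.mem_compl_iff, ih]
  | and φ ψ ih ih' => simp only [sat, Set.mem_inter_iff, ih, ih']

theorem IsAxSubset.preimage {Ax : Set OneStep} (h : BoundedLatticeHom B C) {W : Set C}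
    (hW : IsAxSubset Ax W) : IsAxSubset Ax (h ⁻¹' W) :=
  fun φ hφ θ => (φ.preimage_mem_sat h θ W).2 (hW φ hφ _)

end Naturality

/-! ### The functor `N_Ax` on Boolean algebras -/

/-- The relation `θ(φ) = 1`, where `φ` ranges over `Ax` and `θ` over the assignments in `B`. -/
def AxRel (Ax : Set OneStep) (B : Type u) [BooleanAlgebra B] (x y : FreeBA B) : Prop :=
  ∃ φ ∈ Ax, ∃ θ : ℕ → B, x = φ.interp θ ∧ y = ⊤

/-- The free Boolean algebra on `{□b | b ∈ B}` modulo the congruence generated by `Ax`. -/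
abbrev NAx (Ax : Set OneStep) (B : Type u) [BooleanAlgebra B] : Type u := BAQuot (AxRel Ax B)

/-- The element `□b` of `N_Ax B`. -/
def NAx.box (Ax : Set OneStep) {B : Type u} [BooleanAlgebra B] (b : B) : NAx Ax B :=
  BAQuot.mk (AxRel Ax B) (FreeBA.gen b)

/-- The action of `N_Ax` on a homomorphism, `□b ↦ □(h b)`. -/
def NAx.map (Ax : Set OneStep) {B C : Type u} [BooleanAlgebra B] [BooleanAlgebra C]
    (h : BoundedLatticeHom B C) : BoundedLatticeHom (NAx Ax B) (NAx Ax C) :=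
  BAQuot.lift ((BAQuot.mk (AxRel Ax C)).comp (FreeBA.lift fun b => FreeBA.gen (h b))) (by
    rintro _ _ ⟨φ, hφ, θ, rfl, rfl⟩
    rw [BoundedLatticeHom.comp_apply, φ.lift_interp h θ, map_top]
    exact BAQuot.cls_eq (.of ⟨φ, hφ, _, rfl, rfl⟩))

theorem NAx.map_box (Ax : Set OneStep) {B C : Type u} [BooleanAlgebra B] [BooleanAlgebra C]
    (h : BoundedLatticeHom B C) (b : B) : NAx.map Ax h (NAx.box Ax b) = NAx.box Ax (h b) := rfl

theorem NAx.hom_ext {Ax : Set OneStep} {B : Type u} {C : Type v} [BooleanAlgebra B]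
    [BooleanAlgebra C] {f g : BoundedLatticeHom (NAx Ax B) C}
    (h : ∀ b, f (NAx.box Ax b) = g (NAx.box Ax b)) : f = g :=
  BAQuot.hom_ext (FreeBA.hom_ext h)

/-- The endofunctor `N_Ax` on the category of Boolean algebras. -/
def NAxFunctor (Ax : Set OneStep) : BoolAlg.{u} ⥤ BoolAlg.{u} where
  obj B := BoolAlg.of (NAx Ax B)
  map h := BoolAlg.ofHom (NAx.map Ax h.hom)
  map_id _ := BoolAlg.hom_ext (NAx.hom_ext fun _ => rfl)
  map_comp _ _ := BoolAlg.hom_ext (NAx.hom_ext fun _ => rfl)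

/-! ### Stone duality functors -/

/-- Ultrafilters of a Boolean algebra: proper filters that decide every element. -/
@[ext]
structure UF (B : Type u) [BooleanAlgebra B] where
  carrier : Set B
  top_mem : ⊤ ∈ carrier
  mem_of_le : ∀ {a b}, a ∈ carrier → a ≤ b → b ∈ carrier
  inf_mem : ∀ {a b}, a ∈ carrier → b ∈ carrier → a ⊓ b ∈ carrier
  bot_notMem : ⊥ ∉ carrier
  mem_or_compl_mem : ∀ a, a ∈ carrier ∨ aᶜ ∈ carrier

/-- Criterion for a space to be a Stone space. -/
theorem stone_of_isClosedEmbedding {T : Type u} {I : Type v} [TopologicalSpace T]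
    {f : T → I → Bool} (h : Topology.IsClosedEmbedding f) :
    CompactSpace T ∧ T2Space T ∧ TotallyDisconnectedSpace T :=
  ⟨h.compactSpace, h.isEmbedding.t2Space, ⟨h.isEmbedding.isTotallyDisconnected
    (isTotallyDisconnected_of_totallyDisconnectedSpace _)⟩⟩

/-- A map into `I → Bool` given by a family of subsets is an embedding for the topology generated
by these subsets and their complements. -/
theorem isEmbedding_of_generateFrom {T : Type u} {I : Type v} [t : TopologicalSpace T]
    (P : I → Set T) (hinj : ∀ x y : T, (∀ i, x ∈ P i ↔ y ∈ P i) → x = y)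
    {S : Set (Set T)} (ht : t = generateFrom S)
    (hP : ∀ i, IsOpen (P i)) (hP' : ∀ i, IsOpen (P i)ᶜ)
    (hS : ∀ s ∈ S, ∃ i, s = P i ∨ s = (P i)ᶜ) :
    open Classical in Topology.IsEmbedding (fun (x : T) (i : I) => decide (x ∈ P i)) := by
  classical
  have key : ∀ i, (fun x : T => decide (x ∈ P i)) ⁻¹' {true} = P i := fun i => by
    ext x; simp
  have key' : ∀ i, (fun x : T => decide (x ∈ P i)) ⁻¹' {false} = (P i)ᶜ := fun i => by
    ext x; simp
  have hc : ∀ i, Continuous (fun x : T => decide (x ∈ P i)) := fun i => by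
    rw [continuous_discrete_rng]
    rintro (_ | _)
    · rw [key' i]; exact hP' i
    · rw [key i]; exact hP i
  refine ⟨⟨le_antisymm (continuous_iff_le_induced.1 (continuous_pi hc)) ?_⟩, ?_⟩
  · rw [ht]
    refine le_generateFrom fun s hs => ?_
    obtain ⟨i, rfl | rfl⟩ := hS s hs
    · exact ⟨(fun f : I → Bool => f i) ⁻¹' {true},
        (isOpen_discrete _).preimage (continuous_apply i), key i⟩
    · exact ⟨(fun f : I → Bool => f i) ⁻¹' {false},
        (isOpen_discrete _).preimage (continuous_apply i), key' i⟩
  · intro x y h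
    refine hinj x y fun i => ?_
    simpa using congrFun h i

namespace UF

section

variable {B : Type u} [BooleanAlgebra B]

instance : SetLike (UF B) B where
  coe := UF.carrier
  coe_injective _ _ h := UF.ext h

/-- The basic (clopen) set of ultrafilters containing `b`. -/
def basic (b : B) : Set (UF B) := {p | b ∈ p}

/-- The Stone topology. -/
instance : TopologicalSpace (UF B) := generateFrom (Set.range basic)

theorem compl_mem_iff (p : UF B) (a : B) : aᶜ ∈ p ↔ a ∉ p := by
  refine ⟨fun h h' => p.bot_notMem ?_, (p.mem_or_compl_mem a).resolve_left⟩
  rw [← inf_compl_self a]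
  exact p.inf_mem h' h

theorem inf_mem_iff (p : UF B) (a b : B) : a ⊓ b ∈ p ↔ a ∈ p ∧ b ∈ p :=
  ⟨fun h => ⟨p.mem_of_le h inf_le_left, p.mem_of_le h inf_le_right⟩, fun h => p.inf_mem h.1 h.2⟩

theorem basic_compl (b : B) : basic bᶜ = (basic b)ᶜ := Set.ext fun p => p.compl_mem_iff b

theorem isOpen_basic (b : B) : IsOpen (basic b) := isOpen_generateFrom_of_mem ⟨b, rfl⟩

theorem isClopen_basic (b : B) : IsClopen (basic b) :=
  ⟨⟨basic_compl b ▸ isOpen_basic bᶜ⟩, isOpen_basic b⟩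

theorem isStone (B : Type u) [BooleanAlgebra B] :
    CompactSpace (UF B) ∧ T2Space (UF B) ∧ TotallyDisconnectedSpace (UF B) := by
  classical
  have he := isEmbedding_of_generateFrom (T := UF B) basic
    (fun x y h => UF.ext (Set.ext h)) rfl isOpen_basic
    (fun b => basic_compl b ▸ isOpen_basic bᶜ) (by rintro _ ⟨b, rfl⟩; exact ⟨b, .inl rfl⟩)
  refine stone_of_isClosedEmbedding ⟨he, ?_⟩
  have hr : (Set.range fun (x : UF B) (i : B) => decide (x ∈ basic i)) =
      {f | f ⊤ = true} ∩ {f | f ⊥ = false} ∩ (⋂ a, ⋂ b, {f | f (a ⊓ b) = (f a && f b)}) ∩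
        ⋂ a, {f | f aᶜ = !f a} := by
    ext f
    constructor
    · rintro ⟨p, rfl⟩
      refine ⟨⟨⟨decide_eq_true p.top_mem, decide_eq_false p.bot_notMem⟩, ?_⟩, ?_⟩
      · simp only [Set.mem_iInter]
        intro a b
        change decide (a ⊓ b ∈ p) = (decide (a ∈ p) && decide (b ∈ p))
        simp only [p.inf_mem_iff, Bool.decide_and]
      · simp only [Set.mem_iInter]
        intro a
        change decide (aᶜ ∈ p) = !decide (a ∈ p)
        simp only [p.compl_mem_iff, decide_not]
    · rintro ⟨⟨⟨h1, h2⟩, h3⟩, h4⟩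
      simp only [Set.mem_iInter, Set.mem_ofPred_eq] at h1 h2 h3 h4
      refine ⟨⟨{a | f a = true}, h1, fun {a b} ha hab => ?_, fun {a b} ha hb => ?_, ?_,
        fun a => ?_⟩, ?_⟩
      · have := h3 a b
        rw [inf_eq_left.2 hab] at this
        simp only [Set.mem_ofPred_eq] at ha ⊢
        simpa [ha] using this
      · simp only [Set.mem_ofPred_eq] at ha hb ⊢
        simp [h3, ha, hb]
      · simp [h2]
      · simp only [Set.mem_ofPred_eq, h4]
        cases f a <;> simp
      · funext a
        rcases hfa : f a with _ | _
        · exact decide_eq_false fun h : f a = true => Bool.false_ne_true (hfa.symm.trans h)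
        · exact decide_eq_true hfa
  rw [hr]
  refine ((IsClosed.inter ?_ ?_).inter (isClosed_iInter fun a => isClosed_iInter fun b => ?_)).inter
    (isClosed_iInter fun a => ?_)
  · exact isClosed_eq (continuous_apply _) continuous_const
  · exact isClosed_eq (continuous_apply _) continuous_const
  · have hc : Continuous fun f : B → Bool => (f a && f b) := by
      have hd : Continuous fun q : Bool × Bool => q.1 && q.2 := continuous_of_discreteTopology
      have he : Continuous fun f : B → Bool => (f a, f b) :=
        (continuous_apply a).prodMk (continuous_apply b)
      exact hd.comp he
    exact isClosed_eq (continuous_apply _) hc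
  · exact isClosed_eq (continuous_apply _)
      ((continuous_of_discreteTopology (f := fun q : Bool => !q)).comp (continuous_apply a))

instance : CompactSpace (UF B) := (isStone B).1
instance : T2Space (UF B) := (isStone B).2.1
instance : TotallyDisconnectedSpace (UF B) := (isStone B).2.2

/-- The preimage of an ultrafilter under a homomorphism. -/
def comap {B : Type u} {C : Type v} [BooleanAlgebra B] [BooleanAlgebra C]
    (h : BoundedLatticeHom B C) (p : UF C) : UF B where
  carrier := h ⁻¹' p
  top_mem := by
    rw [Set.mem_preimage, map_top]
    exact p.top_mem
  mem_of_le ha hab := p.mem_of_le ha (OrderHomClass.mono h hab)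
  inf_mem {a b} ha hb := by
    rw [Set.mem_preimage, map_inf]
    exact p.inf_mem ha hb
  bot_notMem := by
    rw [Set.mem_preimage, map_bot]
    exact p.bot_notMem
  mem_or_compl_mem a := by
    rw [Set.mem_preimage, Set.mem_preimage, map_compl']
    exact p.mem_or_compl_mem _

theorem continuous_comap {B : Type u} {C : Type v} [BooleanAlgebra B] [BooleanAlgebra C]
    (h : BoundedLatticeHom B C) : Continuous (comap h) := by
  refine continuous_generateFrom_iff.2 ?_
  rintro _ ⟨b, rfl⟩
  exact isOpen_basic (h b)

/-- Every filter that does not contain `b` extends to an ultrafilter that does not contain `b`. -/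
theorem exists_of_filter (F : Set B) (htop : ⊤ ∈ F)
    (hle : ∀ a b, a ∈ F → a ≤ b → b ∈ F) (hinf : ∀ a b, a ∈ F → b ∈ F → a ⊓ b ∈ F)
    {b : B} (hb : b ∉ F) : ∃ p : UF B, F ⊆ p.carrier ∧ b ∉ p := by
  let F' : Order.PFilter B := Order.IsPFilter.toPFilter (F := F)
    (Order.IsPFilter.of_def ⟨⊤, htop⟩
      (fun x hx y hy => ⟨x ⊓ y, hinf _ _ hx hy, inf_le_left, inf_le_right⟩)
      (fun h h' => hle _ _ h' h))
  have hF' : ∀ x, x ∈ F' ↔ x ∈ F := fun x => Iff.rfl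
  obtain ⟨J, hJ, hIJ, hd⟩ := DistribLattice.prime_ideal_of_disjoint_filter_ideal
    (F := F') (I := Order.Ideal.principal b) (by
      rw [Set.disjoint_left]
      intro x hx hxb
      exact hb (hle _ _ hx hxb))
  have hbJ : b ∈ J := hIJ (Order.Ideal.mem_principal_self)
  have hdis : ∀ x, x ∈ F → x ∉ J := fun x hx hx' => Set.disjoint_left.1 hd hx hx'
  refine ⟨⟨{a | a ∉ J}, hdis _ htop, fun h hab h' => h (J.lower hab h'), fun {x y} hx hy h => ?_,
    fun h => h J.bot_mem, fun a => ?_⟩, hdis, fun h => h hbJ⟩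
  · exact (hJ.mem_or_mem h).elim hx hy
  · by_contra hcon
    simp only [Set.mem_ofPred_eq, not_or, not_not] at hcon
    refine hdis _ htop ?_
    rw [← sup_compl_eq_top (x := a)]
    exact J.sup_mem hcon.1 hcon.2

theorem basic_injective : Function.Injective (basic : B → Set (UF B)) := by
  have hle : ∀ a b : B, basic a ⊆ basic b → a ≤ b := fun a b h => by
    by_contra hab
    obtain ⟨p, hp, hb⟩ := exists_of_filter (Set.Ici a) le_top
      (fun x y hx hxy => le_trans hx hxy) (fun x y hx hy => le_inf hx hy) hab
    exact hb (h (hp (le_refl a)))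
  exact fun a b h => le_antisymm (hle a b h.le) (hle b a h.ge)

theorem exists_basic_eq {s : Set (UF B)} (hs : IsClopen s) : ∃ b, basic b = s := by
  have hinf : ∀ a b : B, basic (a ⊓ b) = basic a ∩ basic b := fun a b =>
    Set.ext fun p => p.inf_mem_iff a b
  have hb : IsTopologicalBasis (Set.range (basic : B → Set (UF B))) :=
    { exists_subset_inter := by
        rintro _ ⟨a, rfl⟩ _ ⟨b, rfl⟩ p hp
        exact ⟨_, ⟨a ⊓ b, rfl⟩, (hinf a b).symm ▸ hp, (hinf a b).le⟩
      sUnion_eq := Set.eq_univ_of_forall fun p => ⟨_, ⟨⊤, rfl⟩, p.top_mem⟩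
      eq_generateFrom := rfl }
  obtain ⟨t, ht, rfl⟩ := eq_finite_iUnion_of_isTopologicalBasis_of_isCompact_open basic hb s
    hs.1.isCompact hs.2
  clear hs
  induction t, ht using Set.Finite.induction_on with
  | empty => exact ⟨⊥, by simpa using Set.eq_empty_of_forall_notMem fun p hp => p.bot_notMem hp⟩
  | @insert a t _ _ ih =>
    obtain ⟨b, hb⟩ := ih
    refine ⟨(aᶜ ⊓ bᶜ)ᶜ, ?_⟩
    rw [Set.biUnion_insert, ← hb, basic_compl, hinf, basic_compl, basic_compl, Set.compl_inter,
      compl_compl, compl_compl]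

end

end UF

/-- The functor sending a Boolean algebra to its Stone space of ultrafilters and a homomorphism to
its inverse image map. -/
def uf : BoolAlg.{u}ᵒᵖ ⥤ Profinite.{u} where
  obj B := Profinite.of (UF B.unop)
  map h := CompHausLike.ofHom _ ⟨UF.comap h.unop.hom, UF.continuous_comap _⟩

/-- The inverse image homomorphism between algebras of clopen sets. -/
def clopenComap {X : Type u} {Y : Type v} [TopologicalSpace X] [TopologicalSpace Y] (f : C(X, Y)) :
    BoundedLatticeHom (Clopens Y) (Clopens X) where
  toFun a := ⟨f ⁻¹' a, a.isClopen.preimage f.continuous⟩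
  map_sup' _ _ := rfl
  map_inf' _ _ := rfl
  map_top' := rfl
  map_bot' := rfl

/-- The functor sending a Stone space to its Boolean algebra of clopen sets and a continuous map to
its inverse image map. -/
def clp : Profinite.{u}ᵒᵖ ⥤ BoolAlg.{u} where
  obj X := BoolAlg.of (Clopens X.unop)
  map f := BoolAlg.ofHom (clopenComap (ConcreteCategory.hom f.unop))

/-- The clopen set of ultrafilters containing `b`. -/
def UF.clopen {B : Type u} [BooleanAlgebra B] (b : B) : Clopens (UF B) :=
  ⟨UF.basic b, UF.isClopen_basic b⟩

/-- Endofunctors `L` on Boolean algebras and `T` on Stone spaces are Stone-duals if `uf` and `clp`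
intertwine them up to natural isomorphism. -/
def StoneDuals (L : BoolAlg.{u} ⥤ BoolAlg.{u}) (T : Profinite.{u} ⥤ Profinite.{u}) : Prop :=
  Nonempty (L.op ⋙ uf ≅ uf ⋙ T) ∧ Nonempty (clp ⋙ L ≅ T.op ⋙ clp)

/-- Let `U` be a contravariant functor. A natural transformation `U L ⟶ T U` sends an `L`-algebra
`α : L B ⟶ B` to the `T`-coalgebra `U B ⟶ U (L B) ⟶ T (U B)`, and an algebra morphism `h` to
`U h`. -/
def dualCoalgebra {C : Type*} [Category* C] {D : Type*} [Category* D] {U : Cᵒᵖ ⥤ D} {L : C ⥤ C}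
    {T : D ⥤ D} (ξ : L.op ⋙ U ⟶ U ⋙ T) :
    (Endofunctor.Algebra L)ᵒᵖ ⥤ Endofunctor.Coalgebra T where
  obj A := ⟨U.obj (op A.unop.a), U.map A.unop.str.op ≫ ξ.app (op A.unop.a)⟩
  map {A A'} h :=
    { f := U.map h.unop.f.op
      h := by
        have h1 : U.map (L.map h.unop.f).op ≫ ξ.app (op A'.unop.a) =
          ξ.app (op A.unop.a) ≫ T.map (U.map h.unop.f.op) := ξ.naturality h.unop.f.op
        have h2 : U.map A.unop.str.op ≫ U.map (L.map h.unop.f).op =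
            U.map h.unop.f.op ≫ U.map A'.unop.str.op := by
          rw [← U.map_comp, ← U.map_comp, ← op_comp, ← op_comp, h.unop.h]
        rw [Category.assoc, ← h1, ← Category.assoc, h2, Category.assoc] }
  map_id A := Endofunctor.Coalgebra.ext (U.map_id (op A.unop.a))
  map_comp f g := Endofunctor.Coalgebra.ext (U.map_comp f.unop.f.op g.unop.f.op)

/-! ### The functor `D_Ax` on Stone spaces -/

/-- The points of the `D`-hyperspace of `X`: sets of clopen subsets of `X`. -/
@[ext]
structure DHyper (X : Type u) [TopologicalSpace X] : Type u where
  sets : Set (Clopens X)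

namespace DHyper

variable {X : Type u} [TopologicalSpace X]

/-- The subbasic set `⊡a = {W | a ∈ W}`. -/
def boxSet (a : Clopens X) : Set (DHyper X) := {W | a ∈ W.sets}

/-- The subbasic set of all `W` with `X \ a ∉ W`. -/
def diaSet (a : Clopens X) : Set (DHyper X) := {W | aᶜ ∉ W.sets}

instance : TopologicalSpace (DHyper X) := generateFrom (Set.range boxSet ∪ Set.range diaSet)

theorem compl_boxSet (a : Clopens X) : (boxSet a)ᶜ = diaSet aᶜ := by
  ext W
  simp [boxSet, diaSet]

theorem isClopen_boxSet (a : Clopens X) : IsClopen (boxSet a) :=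
  ⟨⟨compl_boxSet a ▸ isOpen_generateFrom_of_mem (.inr ⟨_, rfl⟩)⟩,
    isOpen_generateFrom_of_mem (.inl ⟨_, rfl⟩)⟩

theorem isStone (X : Type u) [TopologicalSpace X] :
    CompactSpace (DHyper X) ∧ T2Space (DHyper X) ∧ TotallyDisconnectedSpace (DHyper X) := by
  classical
  have he := isEmbedding_of_generateFrom (T := DHyper X) boxSet
    (fun x y h => DHyper.ext (Set.ext h)) rfl (fun a => (isClopen_boxSet a).2)
    (fun a => (isClopen_boxSet a).compl.2) (by
      rintro _ (⟨b, rfl⟩ | ⟨b, rfl⟩)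
      · exact ⟨b, .inl rfl⟩
      · exact ⟨bᶜ, .inr (by rw [compl_boxSet, compl_compl])⟩)
  refine stone_of_isClosedEmbedding ⟨he, ?_⟩
  convert isClosed_univ
  refine Set.eq_univ_of_forall fun f => ⟨⟨{a | f a = true}⟩, ?_⟩
  funext a
  rcases hfa : f a with _ | _
  · exact decide_eq_false fun h : f a = true => Bool.false_ne_true (hfa.symm.trans h)
  · exact decide_eq_true hfa

instance : CompactSpace (DHyper X) := (isStone X).1
instance : T2Space (DHyper X) := (isStone X).2.1
instance : TotallyDisconnectedSpace (DHyper X) := (isStone X).2.2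

/-- The sets of clopens satisfying a one-step axiom under an assignment form a clopen set. -/
theorem isClopen_sat (φ : OneStep) (θ : ℕ → Clopens X) :
    IsClopen {W : DHyper X | W.sets ∈ φ.sat θ} := by
  induction φ with
  | box π => exact isClopen_boxSet _
  | top => exact isClopen_univ
  | neg φ ih => exact ih.compl
  | and φ ψ ih ih' => exact ih.inter ih'

/-- The map `W ↦ {a | f⁻¹ a ∈ W}`. -/
def map {Y : Type v} [TopologicalSpace Y] (f : C(X, Y)) (W : DHyper X) : DHyper Y :=
  ⟨{a | clopenComap f a ∈ W.sets}⟩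

theorem continuous_map {Y : Type v} [TopologicalSpace Y] (f : C(X, Y)) : Continuous (map f) := by
  refine continuous_generateFrom_iff.2 ?_
  rintro _ (⟨b, rfl⟩ | ⟨b, rfl⟩)
  · exact (isClopen_boxSet (clopenComap f b)).2
  · exact (isClopen_boxSet (clopenComap f bᶜ)).compl.2

end DHyper

/-- The subspace of the `D`-hyperspace of `X` that consists of the `Ax`-subsets of the Boolean
algebra of clopen subsets of `X`. -/
abbrev DAx (Ax : Set OneStep) (X : Type u) [TopologicalSpace X] : Type u :=
  {W : DHyper X // IsAxSubset Ax W.sets}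

namespace DAx

variable (Ax : Set OneStep) {X : Type u} [TopologicalSpace X]

theorem isClosed (X : Type u) [TopologicalSpace X] :
    IsClosed {W : DHyper X | IsAxSubset Ax W.sets} := by
  have : {W : DHyper X | IsAxSubset Ax W.sets} =
      ⋂ φ ∈ Ax, ⋂ θ : ℕ → Clopens X, {W : DHyper X | W.sets ∈ φ.sat θ} := by
    ext W
    simp [IsAxSubset]
  rw [this]
  exact isClosed_biInter fun φ _ => isClosed_iInter fun θ => (DHyper.isClopen_sat φ θ).1

instance : CompactSpace (DAx Ax X) := isCompact_iff_compactSpace.1 (isClosed Ax X).isCompact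

/-- The restriction of `DHyper.map`. -/
def map {Y : Type v} [TopologicalSpace Y] (f : C(X, Y)) : C(DAx Ax X, DAx Ax Y) where
  toFun W := ⟨DHyper.map f W.1, W.2.preimage (clopenComap f)⟩
  continuous_toFun :=
    ((DHyper.continuous_map f).comp continuous_subtype_val).subtype_mk _

end DAx

/-- The endofunctor `D_Ax` on the category of Stone spaces. -/
def DAxFunctor (Ax : Set OneStep) : Profinite.{u} ⥤ Profinite.{u} where
  obj X := Profinite.of (DAx Ax X)
  map f := CompHausLike.ofHom _ (DAx.map Ax (ConcreteCategory.hom f))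

/-! ### Neighborhood algebras and descriptive neighborhood frames -/

/-- Neighborhood algebras: Boolean algebras with an arbitrary unary function. -/
structure NA : Type (u + 1) where
  alg : BoolAlg.{u}
  box : alg → alg

namespace NA

/-- Boolean homomorphisms that preserve the unary function. -/
@[ext]
structure Hom (A B : NA.{u}) : Type u where
  hom : A.alg ⟶ B.alg
  map_box : ∀ a, hom.hom (A.box a) = B.box (hom.hom a)

instance : Category NA.{u} where
  Hom := Hom
  id A := ⟨𝟙 _, fun _ => rfl⟩
  comp f g := ⟨f.hom ≫ g.hom, fun a =>
    (congrArg g.hom.hom (f.map_box a)).trans (g.map_box (f.hom.hom a))⟩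

end NA

/-- An `N_Ax`-algebra `α : N_Ax B ⟶ B` yields the neighborhood algebra on `B` with function
`b ↦ α (□b)`. -/
def algToNA (Ax : Set OneStep) : Endofunctor.Algebra (NAxFunctor.{u} Ax) ⥤ NA.{u} where
  obj A := ⟨A.a, fun b => A.str.hom (NAx.box Ax b)⟩
  map {A B} f := ⟨f.f, fun b =>
    (congrArg (fun k : (NAxFunctor Ax).obj A.a ⟶ B.a => k.hom (NAx.box Ax b)) f.h).symm⟩

/-- Descriptive neighborhood frames `(X, N, A)`: neighborhood frames with a Boolean algebra `A` of
admissible subsets closed under `a ↦ {x | a ∈ N x}` that are tight, differentiated and compact. -/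
structure DNF : Type (u + 1) where
  carrier : Type u
  nbhd : carrier → Set (Set carrier)
  adm : Set (Set carrier)
  univ_mem : Set.univ ∈ adm
  compl_mem : ∀ a ∈ adm, aᶜ ∈ adm
  inter_mem : ∀ a ∈ adm, ∀ b ∈ adm, a ∩ b ∈ adm
  box_mem : ∀ a ∈ adm, {x | a ∈ nbhd x} ∈ adm
  tight : ∀ x, nbhd x ⊆ adm
  differentiated : ∀ x y, x ≠ y → ∃ a ∈ adm, x ∈ a ∧ y ∉ a
  compact : ∀ S ⊆ adm, (∀ F ⊆ S, F.Finite → (⋂₀ F).Nonempty) → (⋂₀ S).Nonempty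

namespace DNF

/-- Maps under which preimages of admissible sets are admissible, and such that an admissible set
is a neighborhood of `f x` exactly if its preimage is a neighborhood of `x`. -/
@[ext]
structure Hom (X Y : DNF.{u}) : Type u where
  toFun : X.carrier → Y.carrier
  preimage_mem : ∀ a ∈ Y.adm, toFun ⁻¹' a ∈ X.adm
  mem_nbhd_iff : ∀ x, ∀ a ∈ Y.adm, a ∈ Y.nbhd (toFun x) ↔ toFun ⁻¹' a ∈ X.nbhd x

instance : Category DNF.{u} where
  Hom := Hom
  id X := ⟨id, fun _ h => h, fun _ _ _ => Iff.rfl⟩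
  comp f g := ⟨g.toFun ∘ f.toFun, fun a ha => f.preimage_mem _ (g.preimage_mem a ha),
    fun x a ha => (g.mem_nbhd_iff _ a ha).trans (f.mem_nbhd_iff x _ (g.preimage_mem a ha))⟩

end DNF

/-- A `D_Ax`-coalgebra `γ` on `X` yields the descriptive neighborhood frame on `X` whose
admissible sets are the clopen sets and in which `γ x` is the set of neighborhoods of `x`. -/
def coalgToDNF (Ax : Set OneStep) :
    Endofunctor.Coalgebra (DAxFunctor.{u} Ax) ⥤ DNF.{u} where
  obj C :=
    { carrier := C.V
      nbhd := fun x => (fun a : Clopens C.V => (a : Set C.V)) '' ((C.str x : DAx Ax C.V).1.sets)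
      adm := {a | IsClopen a}
      univ_mem := isClopen_univ
      compl_mem := fun _ h => h.compl
      inter_mem := fun _ h _ h' => h.inter h'
      box_mem := fun a ha => by
        have hc : Continuous (fun x : C.V => (C.str x : DAx Ax C.V).1) :=
          continuous_subtype_val.comp (ConcreteCategory.hom C.str).continuous
        refine (congrArg IsClopen (Set.ext fun x => ?_)).mpr
          ((DHyper.isClopen_boxSet (⟨a, ha⟩ : Clopens C.V)).preimage hc)
        constructor
        · rintro ⟨c, hc, rfl⟩
          exact hc
        · exact fun h => ⟨_, h, rfl⟩
      tight := by
        rintro x _ ⟨c, -, rfl⟩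
        exact c.isClopen
      differentiated := fun x y h => by
        obtain ⟨a, ha, hx, hy⟩ := exists_isClopen_of_totally_separated h
        exact ⟨a, ha, hx, hy⟩
      compact := fun S hS h => CompactSpace.nonempty_sInter (fun t ht => (hS ht).1)
        fun F hF hfin => h F hF hfin }
  map {C C'} f :=
    { toFun := fun x => f.f x
      preimage_mem := fun a ha => ha.preimage (ConcreteCategory.hom f.f).continuous
      mem_nbhd_iff := fun x a ha => by
        have h := congrArg (fun k : C.V ⟶ (DAxFunctor Ax).obj C'.V =>
          (ConcreteCategory.hom k x : DAx Ax C'.V).1.sets) f.h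
        let a' : Clopens C'.V := ⟨a, ha⟩
        let k : C(C.V, C'.V) := ConcreteCategory.hom f.f
        have h' : a' ∈ (C'.str (f.f x) : DAx Ax C'.V).1.sets ↔
            clopenComap k a' ∈ (C.str x : DAx Ax C.V).1.sets :=
          (Set.ext_iff.1 h a').symm
        constructor
        · rintro ⟨c, hc, hca⟩
          obtain rfl : c = a' := Clopens.ext hca
          exact ⟨_, h'.1 hc, rfl⟩
        · rintro ⟨c, hc, hca⟩
          refine ⟨a', h'.2 ?_, rfl⟩
          have e : clopenComap k a' = c := Clopens.ext hca.symm
          rw [e]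
          exact hc }

/-- The dual frame of a neighborhood algebra `(B, □)`: its points are the ultrafilters of `B`, its
admissible sets are the sets `β b = {p | b ∈ p}`, and the neighborhoods of `p` are the sets
`β b` with `□b ∈ p`. A homomorphism is sent to its inverse image map. -/
def dosenDual : NA.{u}ᵒᵖ ⥤ DNF.{u} where
  obj A :=
    { carrier := UF A.unop.alg
      nbhd := fun p => UF.basic '' {b | A.unop.box b ∈ p}
      adm := Set.range UF.basic
      univ_mem := ⟨⊤, Set.eq_univ_of_forall fun p => p.top_mem⟩
      compl_mem := by
        rintro _ ⟨b, rfl⟩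
        exact ⟨bᶜ, UF.basic_compl b⟩
      inter_mem := by
        rintro _ ⟨a, rfl⟩ _ ⟨b, rfl⟩
        exact ⟨a ⊓ b, Set.ext fun p => p.inf_mem_iff a b⟩
      box_mem := by
        rintro _ ⟨b, rfl⟩
        refine ⟨A.unop.box b, Set.ext fun p => ⟨fun h => ⟨b, h, rfl⟩, ?_⟩⟩
        rintro ⟨c, hc, hcb⟩
        rwa [UF.basic_injective hcb] at hc
      tight := by
        rintro p _ ⟨b, -, rfl⟩
        exact ⟨b, rfl⟩
      differentiated := fun p q h => by
        by_contra! hcon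
        have hle : ∀ b, b ∈ p → b ∈ q := fun b hb => hcon _ ⟨b, rfl⟩ hb
        refine h (SetLike.ext fun b => ⟨hle b, fun hb => ?_⟩)
        by_contra hb'
        exact (q.compl_mem_iff b).1 (hle _ ((p.compl_mem_iff b).2 hb')) hb
      compact := fun S hS h => CompactSpace.nonempty_sInter
        (fun t ht => by
          obtain ⟨b, rfl⟩ := hS ht
          exact (UF.isClopen_basic b).1)
        fun F hF hfin => h F hF hfin }
  map {A A'} h :=
    { toFun := UF.comap h.unop.hom.hom
      preimage_mem := by
        rintro _ ⟨b, rfl⟩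
        exact ⟨h.unop.hom.hom b, rfl⟩
      mem_nbhd_iff := by
        rintro p _ ⟨b, rfl⟩
        have hb := h.unop.map_box b
        constructor
        · rintro ⟨c, hc, hcb⟩
          obtain rfl := UF.basic_injective hcb
          refine ⟨h.unop.hom.hom c, ?_, rfl⟩
          rw [Set.mem_ofPred_eq, ← hb]
          exact hc
        · rintro ⟨c, hc, hcb⟩
          obtain rfl : c = h.unop.hom.hom b := UF.basic_injective hcb
          refine ⟨b, ?_, rfl⟩
          rw [Set.mem_ofPred_eq, ← hb] at hc
          exact hc }

/-! ### Modal algebras and descriptive Kripke frames -/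

/-- Modal algebras: neighborhood algebras whose function preserves finite meets. -/
def isModal : ObjectProperty NA.{u} := fun A =>
  A.box ⊤ = ⊤ ∧ ∀ a b, A.box (a ⊓ b) = A.box a ⊓ A.box b

/-- The category of modal algebras and homomorphisms. -/
abbrev MA : Type (u + 1) := isModal.{u}.FullSubcategory

/-- The set of axioms (N) and (C). -/
def normalAx : Set OneStep := {OneStep.axN, OneStep.axC}

theorem isModal_algToNA (A : Endofunctor.Algebra (NAxFunctor.{u} normalAx)) :
    isModal ((algToNA normalAx).obj A) := by
  have key : ∀ φ ∈ normalAx, ∀ θ : ℕ → A.a,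
      BAQuot.mk (AxRel normalAx A.a) (φ.interp θ) = ⊤ := fun φ hφ θ =>
    BAQuot.cls_eq (.of ⟨φ, hφ, θ, rfl, rfl⟩)
  constructor
  · exact (congrArg A.str.hom (key _ (.inl rfl) fun _ => ⊤)).trans (map_top A.str.hom)
  · intro a b
    have h := key _ (.inr rfl) (fun n => if n = 0 then a else b)
    have e : ∀ x y : NAx normalAx A.a, (x ⊓ yᶜ)ᶜ ⊓ (y ⊓ xᶜ)ᶜ = ⊤ → x = y := fun x y hxy => by
      rw [inf_eq_top_iff, compl_eq_top, compl_eq_top] at hxy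
      exact le_antisymm (disjoint_compl_right_iff.1 (disjoint_iff.2 hxy.1))
        (disjoint_compl_right_iff.1 (disjoint_iff.2 hxy.2))
    simp only [OneStep.axC, OneStep.iff, OneStep.interp, map_inf, map_compl'] at h
    have h2 := congrArg A.str.hom (e _ _ h)
    let g : BoundedLatticeHom (NAx normalAx A.a) A.a := A.str.hom
    let x : NAx normalAx A.a := NAx.box normalAx (B := A.a) a
    let y : NAx normalAx A.a := NAx.box normalAx (B := A.a) b
    exact h2.symm.trans (g.map_inf' x y)

/-- The functor `algToNA` for the axioms (N) and (C), with values in modal algebras. -/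
def algToMA : Endofunctor.Algebra (NAxFunctor.{u} normalAx) ⥤ MA.{u} :=
  isModal.lift (algToNA normalAx) isModal_algToNA

/-- Descriptive Kripke frames: Stone spaces with a continuous relation `R`, that is, each `R[x]` is
closed and `{x | R[x] ∩ a ≠ ∅}` is clopen for each clopen `a`. -/
structure DKF : Type (u + 1) where
  space : Profinite.{u}
  rel : space → space → Prop
  isClosed_image : ∀ x, IsClosed {y | rel x y}
  isClopen_preimage : ∀ a : Set space, IsClopen a → IsClopen {x | ∃ y ∈ a, rel x y}

namespace DKF

/-- Continuous bounded morphisms. -/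
@[ext]
structure Hom (X Y : DKF.{u}) : Type u where
  hom : X.space ⟶ Y.space
  forth : ∀ x y, X.rel x y → Y.rel (hom x) (hom y)
  back : ∀ x z, Y.rel (hom x) z → ∃ y, X.rel x y ∧ hom y = z

instance : Category DKF.{u} where
  Hom := Hom
  id X := ⟨𝟙 _, fun _ _ h => h, fun _ z h => ⟨z, h, rfl⟩⟩
  comp f g := ⟨f.hom ≫ g.hom, fun x y h => g.forth _ _ (f.forth x y h), fun x z h => by
    obtain ⟨y, hy, rfl⟩ := g.back (f.hom x) z h
    obtain ⟨w, hw, rfl⟩ := f.back x y hy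
    exact ⟨w, hw, rfl⟩⟩

end DKF

/-- A descriptive Kripke frame `(X, R)` yields the coalgebra `x ↦ {a clopen | R[x] ⊆ a}`. -/
def dkfToCoalg : DKF.{u} ⥤ Endofunctor.Coalgebra (DAxFunctor.{u} normalAx) where
  obj X :=
    { V := X.space
      str := CompHausLike.ofHom _
        { toFun := fun x => ⟨⟨{a | ∀ y, X.rel x y → y ∈ a}⟩, by
            rintro φ (rfl | rfl) θ
            · exact fun y _ => trivial
            · constructor
              · rintro ⟨⟨h1, h2⟩, h3⟩
                exact h3 fun y hy => ⟨h1 y hy, h2 y hy⟩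
              · rintro ⟨h1, h2⟩
                exact h2 ⟨fun y hy => (h1 y hy).1, fun y hy => (h1 y hy).2⟩⟩
          continuous_toFun := by
            have hcl : ∀ a : Clopens X.space, IsClopen {x | ∀ y, X.rel x y → y ∈ a} := fun a => by
              convert (X.isClopen_preimage _ a.isClopen.compl).compl using 1
              ext x
              simp only [Set.mem_ofPred_eq, Set.mem_compl_iff, SetLike.mem_coe, not_exists, not_and]
              exact forall_congr' fun y => not_imp_not.symm
            refine Continuous.subtype_mk (continuous_generateFrom_iff.2 ?_) _
            rintro _ (⟨b, rfl⟩ | ⟨b, rfl⟩)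
            · exact (hcl b).2
            · exact (hcl bᶜ).compl.2 } }
  map {X Y} f :=
    { f := f.hom
      h := by
        ext x
        refine Subtype.ext (DHyper.ext (Set.ext fun a => ?_))
        constructor
        · intro h z hz
          obtain ⟨y, hy, rfl⟩ := f.back x z hz
          exact h y hy
        · exact fun h y hy => h _ (f.forth x y hy) }

/-- The relation `p R q` iff `a ∈ q` for all `a` with `□a ∈ p`. -/
def canonRel {B : Type u} [BooleanAlgebra B] (box : B → B) (p q : UF B) : Prop :=
  ∀ a, box a ∈ p → a ∈ q

section CanonRel

variable {B : Type u} [BooleanAlgebra B] {box : B → B}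

theorem exists_canonRel (htop : box ⊤ = ⊤) (hinf : ∀ a b, box (a ⊓ b) = box a ⊓ box b)
    {p : UF B} {b : B} (hb : box b ∉ p) : ∃ q, canonRel box p q ∧ b ∉ q := by
  refine UF.exists_of_filter {a | box a ∈ p} ?_ (fun a c ha hac => ?_) (fun a c ha hc => ?_) hb
  · rw [Set.mem_ofPred_eq, htop]
    exact p.top_mem
  · rw [Set.mem_ofPred_eq, ← inf_eq_left.2 hac, hinf] at ha
    exact ((p.inf_mem_iff _ _).1 ha).2
  · rw [Set.mem_ofPred_eq, hinf]
    exact p.inf_mem ha hc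

theorem isClosed_canonRel (box : B → B) (p : UF B) : IsClosed {q | canonRel box p q} := by
  have : {q | canonRel box p q} = ⋂ a, ⋂ _ : box a ∈ p, UF.basic a := by
    ext q
    simp [canonRel, UF.basic]
  rw [this]
  exact isClosed_iInter fun a => isClosed_iInter fun _ => (UF.isClopen_basic a).1

theorem isClopen_canonRel (htop : box ⊤ = ⊤) (hinf : ∀ a b, box (a ⊓ b) = box a ⊓ box b)
    {s : Set (UF B)} (hs : IsClopen s) : IsClopen {p | ∃ q ∈ s, canonRel box p q} := by
  obtain ⟨b, rfl⟩ := UF.exists_basic_eq hs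
  have : {p | ∃ q ∈ UF.basic b, canonRel box p q} = (UF.basic (box bᶜ))ᶜ := by
    ext p
    constructor
    · rintro ⟨q, hq, hpq⟩ h
      exact (q.compl_mem_iff b).1 (hpq _ h) hq
    · intro h
      obtain ⟨q, hpq, hq⟩ := exists_canonRel htop hinf h
      refine ⟨q, ?_, hpq⟩
      by_contra hb
      exact hq ((q.compl_mem_iff b).2 hb)
  rw [this]
  exact (UF.isClopen_basic _).compl

theorem canonRel_back {C : Type u} [BooleanAlgebra C] {box' : C → C} (htop : box' ⊤ = ⊤)
    (hinf : ∀ a b, box' (a ⊓ b) = box' a ⊓ box' b) (h : BoundedLatticeHom B C)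
    (hbox : ∀ b, h (box b) = box' (h b)) {p : UF C} {r : UF B}
    (hr : canonRel box (p.comap h) r) : ∃ q, canonRel box' p q ∧ q.comap h = r := by
  obtain ⟨q, hq, -⟩ := UF.exists_of_filter {c | ∃ a, box' a ∈ p ∧ ∃ d ∈ r, a ⊓ h d ≤ c}
    ⟨⊤, p.mem_of_le p.top_mem htop.ge, ⊤, r.top_mem, le_top⟩
    (fun c c' ⟨a, ha, d, hd, hc⟩ hcc' => ⟨a, ha, d, hd, hc.trans hcc'⟩)
    (fun c c' ⟨a, ha, d, hd, hc⟩ ⟨a', ha', d', hd', hc'⟩ =>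
      ⟨a ⊓ a', by rw [hinf]; exact p.inf_mem ha ha', d ⊓ d', r.inf_mem hd hd', by
        rw [map_inf, inf_inf_inf_comm]; exact inf_le_inf hc hc'⟩)
    (b := ⊥) (by
      rintro ⟨a, ha, d, hd, hle⟩
      have had : a ≤ h dᶜ := by
        rw [map_compl']
        exact (disjoint_iff_inf_le.2 hle).le_compl_right
      have h1 : box' (h dᶜ) ∈ p := by
        rw [← inf_eq_left.2 had, hinf] at ha
        exact ((p.inf_mem_iff _ _).1 ha).2
      rw [← hbox] at h1
      exact (r.compl_mem_iff d).1 (hr _ h1) hd)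
  have hle : ∀ d, d ∈ r → d ∈ q.comap h := fun d hd =>
    hq ⟨⊤, p.mem_of_le p.top_mem htop.ge, d, hd, inf_le_right⟩
  refine ⟨q, fun a ha => hq ⟨a, ha, ⊤, r.top_mem, inf_le_left⟩,
    SetLike.ext fun d => ⟨fun hd => ?_, hle d⟩⟩
  by_contra hd'
  exact ((q.comap h).compl_mem_iff d).1 (hle _ ((r.compl_mem_iff d).2 hd')) hd

end CanonRel

/-- The dual frame of a modal algebra `(B, □)`: the Stone space of ultrafilters of `B` with the
relation `canonRel`. A homomorphism is sent to its inverse image map. -/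
def jonssonTarskiDual : MA.{u}ᵒᵖ ⥤ DKF.{u} where
  obj A :=
    { space := uf.obj (op A.unop.obj.alg)
      rel := canonRel A.unop.obj.box
      isClosed_image := isClosed_canonRel A.unop.obj.box
      isClopen_preimage := fun _ ha =>
        isClopen_canonRel A.unop.property.1 A.unop.property.2 ha }
  map {A A'} h :=
    { hom := uf.map h.unop.hom.hom.op
      forth := fun p q hpq b hb => hpq _ (by
        have e := h.unop.hom.map_box b
        exact (congrArg (fun c => c ∈ UF.carrier p) e).mp hb)
      back := fun _ _ hr =>
        canonRel_back A.unop.property.1 A.unop.property.2 h.unop.hom.hom.hom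
          h.unop.hom.map_box hr }

/-! ### Isomorphisms of categories -/

/-- A functor is an isomorphism of categories if it has a strict inverse. -/
def IsCatIso {C : Type*} [Category* C] {D : Type*} [Category* D] (F : C ⥤ D) : Prop :=
  ∃ G : D ⥤ C, F ⋙ G = 𝟭 C ∧ G ⋙ F = 𝟭 D

end OneStepDuality

open OneStepDuality

/-! An ultrafilter of `NAx Ax B` is a homomorphism from it to the two-element algebra, here `Prop`.
By the universal properties of free algebras and quotients, such a homomorphism is a function on the
generators `□b`, that is, a subset `W` of `B`, for which every instance of every axiom takes the
value true. By induction on formulae (`OneStep.lift_interp_iff`) this says that `W` is an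
`Ax`-subset. Moving `W` along the isomorphism of `B` with the clopen algebra of `UF B` gives a point
of `DAx Ax (UF B)`. The resulting bijection (`bijective_ufToDAx`) is continuous, hence a
homeomorphism of compact Hausdorff spaces. It is the required `ξ`.

The rest of the general theorem is formal once `uf` and `clp` are known to be a dual equivalence:
the isomorphism for `clp` is a conjugate of `ξ` (`nonempty_iso_of_dualEquivalence`), and algebra
structures become coalgebra structures because `uf` is full, faithful and essentially surjective
(`isEquivalence_dualCoalgebra`).

In the special cases, an algebra structure on `B` is a function on `B` that validates the axioms. On
the spatial side, the admissible sets of a descriptive neighborhood frame are exactly the clopen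
sets of the Stone topology that they generate (`DNF.isClopen_iff_mem`). For (N) and (C) the
`Ax`-subsets are the filters of clopen sets, and by compactness these correspond to closed sets,
namely the sets `R[x]` of a Kripke frame (`mem_of_iInter_subset`, `DKF.rel_iff`). The concrete
dualities are compared with the general one by isomorphisms that are the identity on points; for
Kripke frames this needs the ultrafilter theorem in the form `exists_canonRel`. That the concrete
functors are equivalences then follows by cancelling equivalences from a composite. -/

namespace OneStepDuality

/-! ### Isomorphisms of categories and dual equivalences -/

section Categories

universe v₁ v₂ u₁ u₂

variable {C : Type u₁} [Category.{v₁} C] {D : Type u₂} [Category.{v₂} D]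

/-- A fully faithful functor that is bijective on objects is an isomorphism of categories. -/
theorem isCatIso_of_bijective (F : C ⥤ D) [F.Full] [F.Faithful] (h : Function.Bijective F.obj) :
    IsCatIso F := by
  let e : C ≃ D := Equiv.ofBijective F.obj h
  have he : ∀ d, F.obj (e.symm d) = d := e.apply_symm_apply
  have he' : ∀ c, e.symm (F.obj c) = c := e.symm_apply_apply
  let G : D ⥤ C :=
    { obj := e.symm
      -- The object `F.obj (e.symm X)` is only propositionally equal to `X`, so `f` is conjugated by
      -- the transports before fullness is used.
      map := fun {X Y} f => F.preimage (eqToHom (he X) ≫ f ≫ eqToHom (he Y).symm)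
      map_id := fun X => F.map_injective (by simp)
      map_comp := fun f g => F.map_injective (by simp) }
  refine ⟨G, CategoryTheory.Functor.ext he' fun X Y f => F.map_injective ?_,
    CategoryTheory.Functor.ext he fun X Y f => ?_⟩
  · simp [G, eqToHom_map]
  · simp [G]

theorem IsCatIso.isEquivalence {F : C ⥤ D} (h : IsCatIso F) : F.IsEquivalence := by
  obtain ⟨G, h1, h2⟩ := h
  exact (CategoryTheory.Equivalence.mk F G (eqToIso h1.symm) (eqToIso h2)).isEquivalence_functor

/-- The functor on algebras induced by a dual equivalence and a natural isomorphism is a dual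
equivalence. -/
theorem isEquivalence_dualCoalgebra {U : Cᵒᵖ ⥤ D} [U.IsEquivalence] {L : C ⥤ C} {T : D ⥤ D}
    (ξ : L.op ⋙ U ≅ U ⋙ T) : (dualCoalgebra ξ.hom).IsEquivalence where
  faithful :=
    { map_injective := fun {A A'} f g h => by
        have h' : U.map f.unop.f.op = U.map g.unop.f.op :=
          congrArg Endofunctor.Coalgebra.Hom.f h
        exact Quiver.Hom.unop_inj (Endofunctor.Algebra.ext
          (Quiver.Hom.op_inj (U.map_injective h'))) }
  full :=
    { map_surjective := fun {A A'} f => by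
        let k : A'.unop.a ⟶ A.unop.a := (U.preimage f.f).unop
        have hk : U.map k.op = f.f := U.map_preimage f.f
        have hf : (U.map A.unop.str.op ≫ ξ.hom.app (op A.unop.a)) ≫ T.map f.f =
            f.f ≫ U.map A'.unop.str.op ≫ ξ.hom.app (op A'.unop.a) := f.h
        have hn : U.map (L.map k).op ≫ ξ.hom.app (op A'.unop.a) =
            ξ.hom.app (op A.unop.a) ≫ T.map (U.map k.op) := ξ.hom.naturality k.op
        refine ⟨Quiver.Hom.op ⟨k, ?_⟩, Endofunctor.Coalgebra.ext hk⟩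
        -- The algebra square may be checked after the faithful functor `U` and after composing with
        -- the invertible `ξ`; there it is the coalgebra square of `f`.
        apply Quiver.Hom.op_inj
        apply U.map_injective
        rw [← cancel_mono (ξ.hom.app (op A'.unop.a)), op_comp, op_comp, U.map_comp, U.map_comp,
          Category.assoc, Category.assoc, hn, hk]
        exact (Category.assoc _ _ _).symm.trans hf }
  essSurj :=
    { mem_essImage := fun V => by
        let B : C := (U.objPreimage V.V).unop
        let i : U.obj (op B) ≅ V.V := U.objObjPreimageIso V.V
        -- The structure map of `V`, transported to `U B` along `i` and then to `U (L B)` by the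
        -- inverse of `ξ`; fullness of `U` turns it into an algebra structure.
        let α : op B ⟶ op (L.obj B) :=
          U.preimage (i.hom ≫ V.str ≫ T.map i.inv ≫ ξ.inv.app (op B))
        have hα : U.map α = i.hom ≫ V.str ≫ T.map i.inv ≫ ξ.inv.app (op B) := U.map_preimage _
        have hinv : ξ.inv.app (op B) ≫ ξ.hom.app (op B) = 𝟙 _ := ξ.inv_hom_id_app (op B)
        refine ⟨op ⟨B, α.unop⟩, ⟨Endofunctor.Coalgebra.isoMk i ?_⟩⟩
        change (U.map α ≫ ξ.hom.app (op B)) ≫ T.map i.hom = i.hom ≫ V.str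
        rw [hα]
        simp only [Category.assoc]
        rw [reassoc_of% hinv]
        rw [← T.map_comp, i.inv_hom_id, T.map_id, Category.comp_id] }

/-- Duals of natural isomorphisms along a dual equivalence. -/
theorem nonempty_iso_of_dualEquivalence {U : Cᵒᵖ ⥤ D} {V : Dᵒᵖ ⥤ C}
    (unit : 𝟭 Cᵒᵖ ≅ U ⋙ V.rightOp) (counit : V.rightOp ⋙ U ≅ 𝟭 D) {L : C ⥤ C} {T : D ⥤ D}
    (ξ : L.op ⋙ U ≅ U ⋙ T) : Nonempty (V ⋙ L ≅ T.op ⋙ V) := by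
  -- The unit inserts `U` and `V` after `V` and `L`, `ξ` exchanges `L, U` for `U, T`, and the counit
  -- cancels the initial `V, U`.
  have e : V.rightOp ⋙ L.op ≅ T ⋙ V.rightOp :=
    Functor.isoWhiskerLeft (V.rightOp ⋙ L.op) unit ≪≫
      Functor.isoWhiskerLeft V.rightOp (Functor.isoWhiskerRight ξ V.rightOp) ≪≫
      Functor.isoWhiskerRight counit (T ⋙ V.rightOp)
  refine ⟨NatIso.ofComponents (fun X => (e.app X.unop).unop.symm) fun {X Y} f => ?_⟩
  have h := congrArg Quiver.Hom.unop (e.inv.naturality f.unop)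
  exact h.symm

end Categories

/-! ### Stone duality -/

namespace UF

variable {B : Type u} [BooleanAlgebra B]

/-- The characteristic homomorphism of an ultrafilter. -/
def toHom (p : UF B) : BoundedLatticeHom B Prop where
  toFun b := b ∈ p
  map_sup' a b := propext (by
    change a ⊔ b ∈ p ↔ a ∈ p ∨ b ∈ p
    rw [← compl_compl (a ⊔ b), compl_mem_iff, compl_sup, inf_mem_iff, compl_mem_iff,
      compl_mem_iff]
    tauto)
  map_inf' a b := propext (p.inf_mem_iff a b)
  map_top' := eq_true p.top_mem
  map_bot' := eq_false p.bot_notMem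

/-- The ultrafilter with a given characteristic homomorphism. -/
def ofHom (f : BoundedLatticeHom B Prop) : UF B where
  carrier := {b | f b}
  top_mem := of_eq_true (map_top f)
  mem_of_le ha hab := OrderHomClass.mono f hab ha
  inf_mem {a b} ha hb := by
    rw [Set.mem_ofPred_eq, map_inf]
    exact ⟨ha, hb⟩
  bot_notMem := by
    rw [Set.mem_ofPred_eq, map_bot]
    exact id
  mem_or_compl_mem a := by
    rw [Set.mem_ofPred_eq, Set.mem_ofPred_eq, map_compl']
    exact em _

theorem toHom_injective : Function.Injective (toHom : UF B → _) := fun _ _ h =>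
  SetLike.ext fun b => iff_of_eq (DFunLike.congr_fun h b)

variable (B) in
/-- A Boolean algebra is isomorphic to the algebra of clopen sets of its Stone space. -/
noncomputable def clopenEquiv : B ≃o Clopens (UF B) :=
  { Equiv.ofBijective (clopen : B → Clopens (UF B))
      ⟨fun _ _ h => basic_injective (congrArg (fun c : Clopens (UF B) => (c : Set (UF B))) h),
        fun c => (exists_basic_eq c.isClopen).imp fun _ h => Clopens.ext h⟩ with
    map_rel_iff' := fun {a b} => by
      change basic a ⊆ basic b ↔ a ≤ b
      refine ⟨fun h => inf_eq_left.1 (basic_injective (Set.ext fun p => ?_)),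
        fun h p hp => p.mem_of_le hp h⟩
      exact (p.inf_mem_iff a b).trans ⟨And.left, fun hp => ⟨hp, h hp⟩⟩ }

/-- The ultrafilter of clopen sets that contain a given point. -/
def point {X : Type u} [TopologicalSpace X] (x : X) : UF (Clopens X) where
  carrier := {a | x ∈ a}
  top_mem := trivial
  mem_of_le ha hab := hab ha
  inf_mem ha hb := ⟨ha, hb⟩
  bot_notMem := id
  mem_or_compl_mem a := em (x ∈ a)

theorem continuous_point (X : Type u) [TopologicalSpace X] : Continuous (point (X := X)) := by
  refine continuous_generateFrom_iff.2 ?_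
  rintro _ ⟨a, rfl⟩
  exact a.isClopen.2

end UF

/-- A filter of clopen sets in a compact space contains every clopen set that includes the
intersection of the filter. -/
theorem mem_of_iInter_subset {X : Type u} [TopologicalSpace X] [CompactSpace X]
    {W : Set (Clopens X)} (htop : ⊤ ∈ W) (hinf : ∀ a b, a ⊓ b ∈ W ↔ a ∈ W ∧ b ∈ W)
    {b : Clopens X} (hb : ∀ x, (∀ a ∈ W, x ∈ a) → x ∈ b) : b ∈ W := by
  have hne : Nonempty W := ⟨⟨⊤, htop⟩⟩
  have hdir : Directed (· ⊇ ·) fun a : W => ((a : Clopens X) : Set X) := fun a c =>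
    ⟨⟨a ⊓ c, (hinf _ _).2 ⟨a.2, c.2⟩⟩, fun _ hx => hx.1, fun _ hx => hx.2⟩
  -- Compactness: a directed family of closed sets whose intersection lies in an open set has a
  -- member inside that set. The filter is upward closed by the forward direction of `hinf`.
  obtain ⟨a, ha⟩ := exists_subset_nhds_of_isCompact' hdir
    (fun a => a.1.isClopen.1.isCompact) (fun a => a.1.isClopen.1)
    (U := b) (fun x hx => b.isClopen.2.mem_nhds
      (hb x fun a ha => Set.mem_iInter.1 hx ⟨a, ha⟩))
  have hab : (a : Clopens X) ⊓ b = a := inf_eq_left.2 ha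
  exact ((hinf a b).1 (hab.symm ▸ a.2)).2

/-- Distinct points are separated by clopen sets. An ultrafilter of clopen sets has a common point
by compactness; it is contained in the ultrafilter of that point, and inclusion between ultrafilters
is equality. -/
theorem UF.bijective_point (X : Type u) [TopologicalSpace X] [CompactSpace X] [T2Space X]
    [TotallyDisconnectedSpace X] : Function.Bijective (UF.point (X := X)) := by
  refine ⟨fun x y h => ?_, fun p => ?_⟩
  · by_contra hxy
    obtain ⟨a, ha, hx, hy⟩ := exists_isClopen_of_totally_separated hxy
    have hmem : (⟨a, ha⟩ : Clopens X) ∈ UF.point y := h ▸ (show _ ∈ UF.point x from hx)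
    exact hy hmem
  · have : ∃ x, ∀ a ∈ p, x ∈ a := by
      by_contra! hcon
      -- With empty intersection, the filter would contain every clopen set, in particular `⊥`.
      refine p.bot_notMem (mem_of_iInter_subset (W := p.carrier) p.top_mem p.inf_mem_iff
        fun x hx => ?_)
      obtain ⟨a, ha, hxa⟩ := hcon x
      exact (hxa (hx a ha)).elim
    obtain ⟨x, hx⟩ := this
    refine ⟨x, SetLike.ext fun a => ⟨fun ha => ?_, hx a⟩⟩
    by_contra hap
    exact hx _ ((p.compl_mem_iff a).2 hap) ha

/-- The isomorphism between a Boolean algebra and the clopen algebra of its Stone space. -/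
noncomputable def clopenIso (B : BoolAlg.{u}) : B ≅ clp.obj (op (uf.obj (op B))) :=
  BoolAlg.Iso.mk (β := BoolAlg.of (Clopens (UF B))) (UF.clopenEquiv B)

/-- The unit of Stone duality. -/
noncomputable def stoneUnit : 𝟭 BoolAlg.{u}ᵒᵖ ≅ uf ⋙ clp.rightOp :=
  NatIso.ofComponents (fun B => (clopenIso B.unop).symm.op) fun {B C} h => by
    apply Quiver.Hom.unop_inj
    change (clopenIso C.unop).inv ≫ h.unop = clp.map (uf.map h).op ≫ (clopenIso B.unop).inv
    -- With the inverses moved across, both sides send `c` to the clopen set of ultrafilters that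
    -- contain the image of `c`.
    rw [Iso.inv_comp_eq, ← Category.assoc, Iso.eq_comp_inv]
    rfl

/-- The counit of Stone duality. -/
noncomputable def stoneCounit : clp.rightOp ⋙ uf ≅ 𝟭 Profinite.{u} :=
  -- The natural map goes from `X` to the ultrafilters of its clopen algebra, so the counit is its
  -- inverse.
  (NatIso.ofComponents (F := 𝟭 Profinite.{u}) (G := clp.rightOp ⋙ uf)
    (fun X => CompHausLike.isoOfBijective
      (CompHausLike.ofHom _ ⟨UF.point (X := X), UF.continuous_point X⟩ :
        X ⟶ uf.obj (op (clp.obj (op X)))) (UF.bijective_point X))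
    fun _ => rfl).symm

instance isEquivalence_uf : uf.{u}.IsEquivalence :=
  (CategoryTheory.Equivalence.mk uf clp.rightOp stoneUnit stoneCounit).isEquivalence_functor

/-! ### Ultrafilters of `N_Ax B` -/

section Duality

variable {B : Type u} [BooleanAlgebra B]

/-- The bridge between the two semantics of axioms: a subset `W` is a truth valuation of the
generators `□b`, and the connectives in `Prop` match the set operations in `sat`. -/
theorem OneStep.lift_interp_iff (W : Set B) (θ : ℕ → B) (φ : OneStep) :
    FreeBA.lift (fun b => b ∈ W) (φ.interp θ) ↔ W ∈ φ.sat θ := by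
  induction φ with
  | box π => exact Iff.rfl
  | top => exact iff_of_true ((map_top (FreeBA.lift fun b => b ∈ W)).symm ▸ trivial) trivial
  | neg φ ih =>
    rw [interp, map_compl']
    exact not_congr ih
  | and φ ψ ih ih' =>
    rw [interp, map_inf]
    exact and_congr ih ih'

variable {Ax : Set OneStep}

/-- A map on generators that validates the axioms extends to `N_Ax B`. -/
def NAx.lift {C : Type v} [BooleanAlgebra C] (f : B → C)
    (hf : ∀ φ ∈ Ax, ∀ θ : ℕ → B, FreeBA.lift f (φ.interp θ) = ⊤) :
    BoundedLatticeHom (NAx Ax B) C :=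
  BAQuot.lift (FreeBA.lift f) (by
    rintro _ _ ⟨φ, hφ, θ, rfl, rfl⟩
    rw [hf φ hφ θ, map_top])

/-- The pullback of `p` to the free algebra is the valuation of the set in question, and every
instance of an axiom is `⊤` in the quotient, hence in `p`. -/
theorem isAxSubset_of_uf (p : UF (NAx Ax B)) : IsAxSubset Ax {b | NAx.box Ax b ∈ p} := by
  intro φ hφ θ
  have e : FreeBA.lift (fun b => b ∈ {b | NAx.box Ax b ∈ p}) =
      p.toHom.comp (BAQuot.mk (AxRel Ax B)) := FreeBA.hom_ext fun _ => rfl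
  rw [← OneStep.lift_interp_iff, e]
  have h : BAQuot.mk (AxRel Ax B) (φ.interp θ) = ⊤ := BAQuot.cls_eq (.of ⟨φ, hφ, θ, rfl, rfl⟩)
  change BAQuot.mk (AxRel Ax B) (φ.interp θ) ∈ p
  rw [h]
  exact p.top_mem

/-- An order isomorphism as a homomorphism. -/
def orderIsoHom {C : Type v} [BooleanAlgebra C] (e : B ≃o C) : BoundedLatticeHom B C where
  toFun := e
  map_sup' := e.map_sup
  map_inf' := e.map_inf
  map_top' := e.map_top
  map_bot' := e.map_bot

/-- The map from ultrafilters of `N_Ax B` to `Ax`-subsets of the clopen algebra of `uf B`. -/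
noncomputable def ufToDAx (Ax : Set OneStep) (B : Type u) [BooleanAlgebra B]
    (p : UF (NAx Ax B)) : DAx Ax (UF B) :=
  ⟨⟨{a | NAx.box Ax ((UF.clopenEquiv B).symm a) ∈ p}⟩,
    (isAxSubset_of_uf p).preimage (orderIsoHom (UF.clopenEquiv B).symm)⟩

/-- Since every clopen set of `UF B` has the form `UF.clopen b`, this determines `ufToDAx` without
reference to the inverse of `clopenEquiv`. -/
theorem clopen_mem_ufToDAx (p : UF (NAx Ax B)) (b : B) :
    UF.clopen b ∈ (ufToDAx Ax B p).1.sets ↔ NAx.box Ax b ∈ p := by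
  change NAx.box Ax ((UF.clopenEquiv B).symm (UF.clopenEquiv B b)) ∈ p ↔ _
  rw [OrderIso.symm_apply_apply]

theorem continuous_ufToDAx : Continuous (ufToDAx Ax B) := by
  refine Continuous.subtype_mk (continuous_generateFrom_iff.2 ?_) _
  rintro _ (⟨a, rfl⟩ | ⟨a, rfl⟩)
  · exact UF.isOpen_basic (NAx.box Ax ((UF.clopenEquiv B).symm a))
  · exact (UF.isClopen_basic (NAx.box Ax ((UF.clopenEquiv B).symm aᶜ))).compl.2

/-- Homomorphisms from `NAx Ax B` to `Prop` are determined by the generators, and any `Ax`-subset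
prescribes admissible values on them. -/
theorem bijective_ufToDAx : Function.Bijective (ufToDAx Ax B) := by
  refine ⟨fun p q h => UF.toHom_injective (NAx.hom_ext fun b => propext ?_), fun W => ?_⟩
  · exact (clopen_mem_ufToDAx p b).symm.trans (h ▸ clopen_mem_ufToDAx q b)
  · have hW := W.2.preimage (orderIsoHom (UF.clopenEquiv B))
    refine ⟨UF.ofHom (NAx.lift (fun b => b ∈ orderIsoHom (UF.clopenEquiv B) ⁻¹' W.1.sets)
      fun φ hφ θ => eq_true ((OneStep.lift_interp_iff _ θ φ).2 (hW φ hφ θ))), ?_⟩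
    refine Subtype.ext (DHyper.ext (Set.ext fun a => ?_))
    change UF.clopenEquiv B ((UF.clopenEquiv B).symm a) ∈ W.1.sets ↔ _
    rw [OrderIso.apply_symm_apply]

end Duality

/-- The duality between `N_Ax` and `D_Ax`. -/
noncomputable def ufNAxIso (Ax : Set OneStep) :
    (NAxFunctor.{u} Ax).op ⋙ uf ≅ uf ⋙ DAxFunctor.{u} Ax :=
  NatIso.ofComponents (fun B => CompHausLike.isoOfBijective
    (CompHausLike.ofHom _ ⟨ufToDAx Ax B.unop, continuous_ufToDAx⟩ :
      uf.obj (op ((NAxFunctor Ax).obj B.unop)) ⟶ (DAxFunctor Ax).obj (uf.obj B))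
    bijective_ufToDAx) fun {B C} h => by
      ext p
      refine Subtype.ext (DHyper.ext (Set.ext fun a => ?_))
      obtain ⟨c, rfl⟩ := (UF.clopenEquiv C.unop).surjective a
      exact (clopen_mem_ufToDAx (UF.comap (NAx.map Ax h.unop.hom) p) c).trans
        (clopen_mem_ufToDAx p (h.unop.hom c)).symm

theorem clopen_mem_ufNAxIso (Ax : Set OneStep) (B : BoolAlg.{u}) (p : UF (NAx Ax B)) (b : B) :
    UF.clopen b ∈ ((ufNAxIso Ax).hom.app (op B) p : DAx Ax (UF B)).1.sets ↔
      NAx.box Ax b ∈ p :=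
  clopen_mem_ufToDAx p b

theorem stoneDuals (Ax : Set OneStep) : StoneDuals (NAxFunctor.{u} Ax) (DAxFunctor.{u} Ax) :=
  ⟨⟨ufNAxIso Ax⟩, nonempty_iso_of_dualEquivalence stoneUnit stoneCounit (ufNAxIso Ax)⟩

/-! ### Algebras and neighborhood algebras -/

section Algebras

variable (Ax : Set OneStep)

instance : (algToNA.{u} Ax).Faithful where
  map_injective h := Endofunctor.Algebra.ext (congrArg NA.Hom.hom h)

instance : (algToNA.{u} Ax).Full where
  map_surjective f :=
    ⟨⟨f.hom, BoolAlg.hom_ext (NAx.hom_ext fun b => (f.map_box b).symm)⟩, rfl⟩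

theorem algToNA_obj_injective : Function.Injective (algToNA.{u} Ax).obj := by
  rintro ⟨B, α⟩ ⟨B', α'⟩ h
  injection h with h1 h2
  cases h1
  have h3 := eq_of_heq h2
  have h4 : α = α' := BoolAlg.hom_ext (NAx.hom_ext fun b => congrFun h3 b)
  rw [h4]

/-- The universal property of `NAx`: a function that validates the axioms extends to an algebra
structure. -/
theorem exists_algToNA_obj_eq (A : NA.{u})
    (hA : ∀ φ ∈ Ax, ∀ θ : ℕ → A.alg, FreeBA.lift A.box (φ.interp θ) = ⊤) :
    ∃ A', (algToNA Ax).obj A' = A :=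
  ⟨⟨A.alg, BoolAlg.ofHom (NAx.lift A.box hA)⟩, rfl⟩

theorem isCatIso_algToNA_empty : IsCatIso (algToNA.{u} ∅) :=
  isCatIso_of_bijective _ ⟨algToNA_obj_injective ∅, fun A =>
    exists_algToNA_obj_eq ∅ A fun _ h => h.elim⟩

theorem isCatIso_algToMA : IsCatIso algToMA.{u} := by
  have : algToMA.{u}.Full := inferInstanceAs (isModal.lift (algToNA normalAx) _).Full
  have : algToMA.{u}.Faithful := inferInstanceAs (isModal.lift (algToNA normalAx) _).Faithful
  refine isCatIso_of_bijective _ ⟨fun A A' h => algToNA_obj_injective normalAx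
    (congrArg ObjectProperty.FullSubcategory.obj h), fun A => ?_⟩
  obtain ⟨A', hA'⟩ := exists_algToNA_obj_eq normalAx A.obj (by
    rintro φ (rfl | rfl) θ
    · exact A.property.1
    -- Preservation of meets gives both sides of (C) the same value, so both implications reduce to
    -- the complement of `⊥`.
    · simp only [OneStep.axC, OneStep.iff, OneStep.interp, FreeBA.lift_gen, PForm.eval, map_inf,
        map_compl', A.property.2, inf_compl_self, compl_bot, inf_top_eq])
  exact ⟨A', ObjectProperty.FullSubcategory.ext hA'⟩

end Algebras

/-! ### Coalgebras and descriptive neighborhood frames -/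

theorem mem_coe_image_iff {X : Type u} [TopologicalSpace X] {W : Set (Clopens X)} {a : Set X}
    (ha : IsClopen a) : a ∈ (fun c : Clopens X => (c : Set X)) '' W ↔ ⟨a, ha⟩ ∈ W := by
  constructor
  · rintro ⟨c, hc, rfl⟩
    exact hc
  · exact fun h => ⟨_, h, rfl⟩

/-- This recovers the topology of a coalgebra from the admissible sets of its frame. -/
theorem stone_eq_generateFrom (X : Type u) [t : TopologicalSpace X] [CompactSpace X] [T2Space X]
    [TotallyDisconnectedSpace X] : t = generateFrom {a | IsClopen a} :=
  isTopologicalBasis_isClopen.eq_generateFrom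

namespace DNF

variable (F : DNF.{u})

/-- The topology generated by the admissible sets. -/
abbrev topology : TopologicalSpace F.carrier := generateFrom F.adm

theorem isClopen_of_mem {a : Set F.carrier} (ha : a ∈ F.adm) : @IsClopen _ F.topology a :=
  letI := F.topology
  ⟨⟨isOpen_generateFrom_of_mem (F.compl_mem a ha)⟩, isOpen_generateFrom_of_mem ha⟩

/-- The frame condition tests the finite intersection property only on admissible sets. This
suffices because they form a subbase closed under complements. -/
theorem compactSpace : @CompactSpace F.carrier F.topology := by
  let := F.topology
  exact compactSpace_generateFrom_of_compl_mem F.adm rfl F.compl_mem F.compact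

theorem totallySeparatedSpace : @TotallySeparatedSpace F.carrier F.topology := by
  let := F.topology
  refine totallySeparatedSpace_iff_exists_isClopen.2 fun x y h => ?_
  obtain ⟨a, ha, hx, hy⟩ := F.differentiated x y h
  exact ⟨a, F.isClopen_of_mem ha, hx, hy⟩

/-- The admissible sets form a base, being closed under finite intersections. A clopen set is
compact, hence a finite union of them, and they are closed under finite unions by De Morgan. -/
theorem isClopen_iff_mem (a : Set F.carrier) : @IsClopen _ F.topology a ↔ a ∈ F.adm := by
  let := F.topology
  have := F.compactSpace
  refine ⟨fun ha => ?_, F.isClopen_of_mem⟩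
  have hb : IsTopologicalBasis F.adm := isTopologicalBasis_of_subbasis_of_finiteInter rfl
    ⟨F.univ_mem, fun {s} hs {t} ht => F.inter_mem s hs t ht⟩
  obtain ⟨t, ht, rfl⟩ := eq_finite_iUnion_of_isTopologicalBasis_of_isCompact_open
    (fun a : F.adm => (a : Set F.carrier)) (by rwa [Subtype.range_coe]) a ha.1.isCompact ha.2
  clear ha
  induction t, ht using Set.Finite.induction_on with
  | empty => simpa using F.compl_mem _ F.univ_mem
  | @insert a t _ _ ih =>
    rw [Set.biUnion_insert, ← compl_compl (_ ∪ _), Set.compl_union]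
    exact F.compl_mem _ (F.inter_mem _ (F.compl_mem _ a.2) _ (F.compl_mem _ ih))

/-- Isomorphisms of descriptive neighborhood frames from bijections. -/
def isoMk {F G : DNF.{u}} (e : F.carrier ≃ G.carrier)
    (hadm : ∀ a, a ∈ G.adm ↔ e ⁻¹' a ∈ F.adm)
    (hnbhd : ∀ x a, a ∈ G.nbhd (e x) ↔ e ⁻¹' a ∈ F.nbhd x) : F ≅ G where
  hom := ⟨e, fun a ha => (hadm a).1 ha, fun x a _ => hnbhd x a⟩
  inv := ⟨e.symm, fun a ha => (hadm _).2 (by rwa [e.preimage_symm_preimage]), fun x a _ => by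
    rw [← e.preimage_symm_preimage a, ← hnbhd, e.apply_symm_apply, e.preimage_symm_preimage]⟩
  hom_inv_id := DNF.Hom.ext (funext e.symm_apply_apply)
  inv_hom_id := DNF.Hom.ext (funext e.apply_symm_apply)

end DNF

section Coalgebras

variable (Ax : Set OneStep)

instance : (coalgToDNF.{u} Ax).Faithful where
  map_injective h := Endofunctor.Coalgebra.ext
    (ConcreteCategory.hom_ext _ _ (congrFun (congrArg DNF.Hom.toFun h)))

instance : (coalgToDNF.{u} Ax).Full where
  map_surjective {C C'} f := by
    -- Continuity is tested on the base of clopen sets, where it is the preimage condition on frame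
    -- morphisms.
    let k : C(C.V, C'.V) := ⟨f.toFun, isTopologicalBasis_isClopen.continuous_iff.2
      fun a ha => (f.preimage_mem a ha).2⟩
    refine ⟨⟨CompHausLike.ofHom _ k, ?_⟩, rfl⟩
    ext x
    refine Subtype.ext (DHyper.ext (Set.ext fun a => ?_))
    have h := f.mem_nbhd_iff x (a : Set C'.V) a.isClopen
    exact ((mem_coe_image_iff (a.isClopen.preimage k.continuous)).symm.trans h.symm).trans
      (mem_coe_image_iff a.isClopen)

theorem coalgToDNF_obj_injective : Function.Injective (coalgToDNF.{u} Ax).obj := by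
  rintro ⟨@⟨@⟨X, s⟩, hs, hs', hs''⟩, γ⟩ ⟨@⟨@⟨Y, t⟩, ht, ht', ht''⟩, γ'⟩ h
  injection h with h1 h2 h3
  change X = Y at h1
  subst h1
  have h4 : s = t := (@stone_eq_generateFrom X s hs hs' hs'').trans
    ((congrArg generateFrom (eq_of_heq h3)).trans (@stone_eq_generateFrom X t ht ht' ht'').symm)
  subst h4
  have h5 : γ = γ' := by
    ext x
    refine Subtype.ext (DHyper.ext ?_)
    exact Set.image_injective.2 SetLike.coe_injective (congrFun (eq_of_heq h2) x)
  subst h5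
  rfl

/-- The topology is generated by the admissible sets, which are then its clopen sets. Closure under
the box operation makes the neighborhood map continuous, and tightness ensures that passing to
clopen sets loses no neighborhood. -/
theorem coalgToDNF_empty_obj_surjective : Function.Surjective (coalgToDNF.{u} ∅).obj := by
  intro F
  let := F.topology
  have := F.compactSpace
  have := F.totallySeparatedSpace
  let γ : C(F.carrier, DAx ∅ F.carrier) :=
    { toFun := fun x => ⟨⟨{a | (a : Set F.carrier) ∈ F.nbhd x}⟩, fun _ h => h.elim⟩
      continuous_toFun := by
        have hcl : ∀ a : Clopens F.carrier, IsClopen {x | (a : Set F.carrier) ∈ F.nbhd x} :=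
          fun a => F.isClopen_of_mem (F.box_mem _ ((F.isClopen_iff_mem _).1 a.isClopen))
        refine Continuous.subtype_mk (continuous_generateFrom_iff.2 ?_) _
        rintro _ (⟨a, rfl⟩ | ⟨a, rfl⟩)
        · exact (hcl a).2
        · exact (hcl aᶜ).compl.2 }
  let C : Endofunctor.Coalgebra (DAxFunctor.{u} ∅) :=
    ⟨Profinite.of F.carrier, CompHausLike.ofHom _ γ⟩
  have hadm : ((coalgToDNF ∅).obj C).adm = F.adm := Set.ext F.isClopen_iff_mem
  have hnbhd : ((coalgToDNF ∅).obj C).nbhd = F.nbhd := by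
    funext x
    refine Set.ext fun a => ⟨?_, fun ha => ?_⟩
    · rintro ⟨c, hc, rfl⟩
      exact hc
    · exact ⟨⟨a, F.isClopen_of_mem (F.tight x ha)⟩, ha, rfl⟩
  refine ⟨C, ?_⟩
  cases F
  exact (DNF.mk.injEq ..).mpr ⟨rfl, heq_of_eq hnbhd, heq_of_eq hadm⟩

theorem isCatIso_coalgToDNF_empty : IsCatIso (coalgToDNF.{u} ∅) :=
  isCatIso_of_bijective _ ⟨coalgToDNF_obj_injective ∅, coalgToDNF_empty_obj_surjective⟩

end Coalgebras

/-! ### Došen duality -/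

/-- The frames of an algebra and of its dual coalgebra are isomorphic. -/
noncomputable def dosenIso : (algToNA.{u} ∅).op ⋙ dosenDual ≅
    dualCoalgebra (ufNAxIso.{u} ∅).hom ⋙ coalgToDNF.{u} ∅ :=
  NatIso.ofComponents (fun A => DNF.isoMk (Equiv.refl (UF A.unop.a))
    (fun a => ⟨fun ha => UF.exists_basic_eq ha, by
      rintro ⟨b, hb⟩
      exact (congrArg IsClopen hb).mp (UF.isClopen_basic b)⟩)
    fun p a => by
      -- The image of `p` under the dual of the structure map: `□b ∈ q` means that the value of the
      -- structure map at `□b` lies in `p`.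
      let q : UF (NAx ∅ A.unop.a) := UF.comap A.unop.str.hom p
      constructor
      · rintro ⟨c, hc, rfl⟩
        obtain ⟨b, rfl⟩ := (UF.clopenEquiv A.unop.a).surjective c
        exact ⟨b, (clopen_mem_ufToDAx q b).1 hc, rfl⟩
      · rintro ⟨b, hb, hba⟩
        exact ⟨UF.clopen b, (clopen_mem_ufToDAx q b).2 hb, hba⟩)
    fun _ => rfl

/-- Two out of three: by `dosenIso` the composite with the equivalence `algToNA` is an equivalence.
-/
theorem isEquivalence_dosenDual : dosenDual.{u}.IsEquivalence := by
  have := (isCatIso_algToNA_empty.{u}).isEquivalence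
  have := (isCatIso_coalgToDNF_empty.{u}).isEquivalence
  have := isEquivalence_dualCoalgebra (ufNAxIso.{u} ∅)
  have : ((algToNA.{u} ∅).op ⋙ dosenDual).IsEquivalence :=
    Functor.isEquivalence_of_iso dosenIso.symm
  exact Functor.isEquivalence_of_comp_left (algToNA.{u} ∅).op dosenDual

/-! ### Coalgebras and descriptive Kripke frames -/

theorem IsAxSubset.top_mem {B : Type u} [BooleanAlgebra B] {W : Set B}
    (hW : IsAxSubset normalAx W) : ⊤ ∈ W :=
  hW _ (.inl rfl) fun _ => ⊤

/-- Together with `IsAxSubset.top_mem`, this says that the subsets for (N) and (C) are filters. -/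
theorem IsAxSubset.inf_mem_iff {B : Type u} [BooleanAlgebra B] {W : Set B}
    (hW : IsAxSubset normalAx W) (a b : B) : a ⊓ b ∈ W ↔ a ∈ W ∧ b ∈ W := by
  -- Only the variables 0 and 1 occur in (C); they receive `a` and `b`.
  have h := hW _ (.inr rfl) (fun n => if n = 0 then a else b)
  have h' : ¬ ((a ∈ W ∧ b ∈ W) ∧ ¬ a ⊓ b ∈ W) ∧ ¬ (a ⊓ b ∈ W ∧ ¬ (a ∈ W ∧ b ∈ W)) := h
  tauto

theorem exists_clopens_of_notMem {X : Type u} [TopologicalSpace X] [CompactSpace X] [T2Space X]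
    [TotallyDisconnectedSpace X] {s : Set X} (hs : IsClosed s) {y : X} (hy : y ∉ s) :
    ∃ a : Clopens X, s ⊆ a ∧ y ∉ a := by
  obtain ⟨V, hV, hyV, hVs⟩ := compact_exists_isClopen_in_isOpen hs.isOpen_compl hy
  exact ⟨⟨Vᶜ, hV.compl⟩, Set.subset_compl_comm.1 hVs, fun h => h hyV⟩

/-- A closed set in a Stone space is the intersection of the clopen sets around it, so `R[x]` can be
recovered from the coalgebra. -/
theorem DKF.rel_iff (X : DKF.{u}) (x y : X.space) :
    X.rel x y ↔ ∀ a : Clopens X.space, (∀ z, X.rel x z → z ∈ a) → y ∈ a := by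
  refine ⟨fun h a ha => ha y h, fun h => ?_⟩
  by_contra hxy
  obtain ⟨a, ha, hy⟩ := exists_clopens_of_notMem (X.isClosed_image x) hxy
  exact hy (h a fun z hz => ha hz)

instance : dkfToCoalg.{u}.Faithful where
  map_injective h := DKF.Hom.ext (congrArg Endofunctor.Coalgebra.Hom.f h)

/-- A coalgebra morphism satisfies `key`: a clopen set includes the image of `R[x]` exactly if it
includes the successors of the image of `x`. Both sets are closed, the first by compactness, so they
coincide; the two inclusions are the forth and back conditions. -/
instance : dkfToCoalg.{u}.Full where
  map_surjective {X Y} f := by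
    let k : C(X.space, Y.space) := ConcreteCategory.hom f.f
    have key : ∀ (x : X.space) (a : Clopens Y.space),
        (∀ y, X.rel x y → k y ∈ a) ↔ ∀ z, Y.rel (k x) z → z ∈ a := fun x a =>
      Set.ext_iff.1 (congrArg (fun g : X.space ⟶ (DAxFunctor normalAx).obj Y.space =>
        (ConcreteCategory.hom g x : DAx normalAx Y.space).1.sets) f.h) a
    refine ⟨⟨f.f, fun x y hxy => ?_, fun x z hz => ?_⟩, rfl⟩
    · exact (Y.rel_iff _ _).2 fun a ha => (key x a).2 ha y hxy
    · by_contra! hcon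
      obtain ⟨a, ha, hza⟩ := exists_clopens_of_notMem (s := k '' {y | X.rel x y}) (y := z)
        ((X.isClosed_image x).isCompact.image k.continuous).isClosed
        (by rintro ⟨y, hy, hyz⟩; exact hcon y hy hyz)
      exact hza ((key x a).1 (fun y hy => ha ⟨y, hy, rfl⟩) z hz)

theorem dkfToCoalg_obj_injective : Function.Injective dkfToCoalg.{u}.obj := by
  rintro ⟨X, R, hX, hX'⟩ ⟨Y, S, hY, hY'⟩ h
  injection h with h1 h2
  cases h1
  have h3 := eq_of_heq h2
  have h4 : R = S := by
    funext x y
    have h5 : ∀ a : Clopens X, (∀ z, R x z → z ∈ a) ↔ ∀ z, S x z → z ∈ a := fun a =>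
      Set.ext_iff.1 (congrArg (fun g : X ⟶ (DAxFunctor normalAx).obj X =>
        (ConcreteCategory.hom g x : DAx normalAx X).1.sets) h3) a
    refine propext ((DKF.rel_iff ⟨X, R, hX, hX'⟩ x y).trans
      (Iff.trans ?_ (DKF.rel_iff ⟨X, S, hY, hY'⟩ x y).symm))
    exact forall_congr' fun a => imp_congr_left (h5 a)
  subst h4
  rfl

/-- The successors of `x` are the common points of the filter at `x`. By compactness (`hg`) the
clopen sets around this closed set are just the members of the filter. -/
theorem dkfToCoalg_obj_surjective : Function.Surjective dkfToCoalg.{u}.obj := by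
  rintro ⟨X, γ⟩
  let g : C(X, DAx normalAx X) := ConcreteCategory.hom γ
  have hg : ∀ (x : X) (b : Clopens X),
      (∀ y, (∀ a ∈ (g x).1.sets, y ∈ a) → y ∈ b) ↔ b ∈ (g x).1.sets := fun x b =>
    ⟨mem_of_iInter_subset (g x).2.top_mem (g x).2.inf_mem_iff, fun hb y hy => hy b hb⟩
  let Y : DKF.{u} :=
    { space := X
      rel := fun x y => ∀ a ∈ (g x).1.sets, y ∈ a
      isClosed_image := fun x => by
        simp only [Set.ofPred_forall]
        exact isClosed_iInter fun a => isClosed_iInter fun _ => a.isClopen.1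
      isClopen_preimage := fun s hs => by
        have hc : Continuous fun x => (g x).1 := continuous_subtype_val.comp g.continuous
        -- `R[x]` meets `s` exactly if the complement of `s` is not in the filter at `x`.
        convert ((DHyper.isClopen_boxSet (⟨s, hs⟩ : Clopens X)ᶜ).preimage hc).compl using 1
        ext x
        refine Iff.trans ?_ (not_congr (hg x _))
        simp only [not_forall]
        exact exists_congr fun y => ⟨fun h => ⟨h.2, fun h' => h' h.1⟩,
          fun ⟨h, h'⟩ => ⟨not_not.1 h', h⟩⟩ }
  refine ⟨Y, ?_⟩
  have h : (dkfToCoalg.obj Y).str = γ := by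
    ext x
    exact Subtype.ext (DHyper.ext (Set.ext (hg x)))
  exact congrArg (Endofunctor.Coalgebra.mk X) h

theorem isCatIso_dkfToCoalg : IsCatIso dkfToCoalg.{u} :=
  isCatIso_of_bijective _ ⟨dkfToCoalg_obj_injective, dkfToCoalg_obj_surjective⟩

/-! ### Jónsson–Tarski duality -/

/-- The coalgebra of the canonical frame of an algebra is the dual coalgebra. -/
noncomputable def jonssonTarskiIso : algToMA.{u}.op ⋙ jonssonTarskiDual ⋙ dkfToCoalg ≅
    dualCoalgebra (ufNAxIso.{u} normalAx).hom :=
  NatIso.ofComponents (fun A => Endofunctor.Coalgebra.isoMk (Iso.refl (uf.obj (op A.unop.a))) (by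
    have hmod := isModal_algToNA A.unop
    ext p
    refine Subtype.ext (DHyper.ext (Set.ext fun c => ?_))
    obtain ⟨b, rfl⟩ := (UF.clopenEquiv A.unop.a).surjective c
    let q : UF (NAx normalAx A.unop.a) := UF.comap A.unop.str.hom p
    -- All successors of `p` contain `b` exactly if the box of `b` lies in `p`; otherwise
    -- `exists_canonRel` provides a successor without `b`.
    refine Iff.trans ⟨fun h => ?_, fun h r hr => hr b h⟩ (clopen_mem_ufToDAx q b).symm
    by_contra hb
    obtain ⟨r, hr, hbr⟩ := exists_canonRel hmod.1 hmod.2 hb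
    exact hbr (h r hr)))
    fun _ => rfl

/-- The composite in `jonssonTarskiIso` is an equivalence, and its outer factors cancel because they
are isomorphisms of categories. -/
theorem isEquivalence_jonssonTarskiDual : jonssonTarskiDual.{u}.IsEquivalence := by
  have := (isCatIso_algToMA.{u}).isEquivalence
  have := (isCatIso_dkfToCoalg.{u}).isEquivalence
  have := isEquivalence_dualCoalgebra (ufNAxIso.{u} normalAx)
  have : (algToMA.{u}.op ⋙ jonssonTarskiDual ⋙ dkfToCoalg).IsEquivalence :=
    Functor.isEquivalence_of_iso jonssonTarskiIso.symm
  have := Functor.isEquivalence_of_comp_left algToMA.{u}.op (jonssonTarskiDual ⋙ dkfToCoalg)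
  exact Functor.isEquivalence_of_comp_right jonssonTarskiDual dkfToCoalg

end OneStepDuality

/-! ### The main theorem -/

theorem mainTheorem2 :
    (∀ Ax : Set OneStep, StoneDuals (NAxFunctor.{u} Ax) (DAxFunctor.{u} Ax)) ∧
    ∃ ξ : ∀ Ax : Set OneStep, (NAxFunctor.{u} Ax).op ⋙ uf ≅ uf ⋙ DAxFunctor.{u} Ax,
      (∀ (Ax : Set OneStep) (B : BoolAlg.{u}) (p : UF (NAx Ax B)) (b : B),
        UF.clopen b ∈ ((ξ Ax).hom.app (op B) p : DAx Ax (UF B)).1.sets ↔ NAx.box Ax b ∈ p) ∧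
      (∀ Ax : Set OneStep, (dualCoalgebra (ξ Ax).hom).IsEquivalence) ∧
      (IsCatIso (algToNA.{u} ∅) ∧ IsCatIso (coalgToDNF.{u} ∅) ∧
        dosenDual.{u}.IsEquivalence ∧
        Nonempty ((algToNA.{u} ∅).op ⋙ dosenDual ≅
          dualCoalgebra (ξ ∅).hom ⋙ coalgToDNF.{u} ∅)) ∧
      (IsCatIso algToMA.{u} ∧ IsCatIso dkfToCoalg.{u} ∧
        jonssonTarskiDual.{u}.IsEquivalence ∧
        Nonempty (algToMA.{u}.op ⋙ jonssonTarskiDual ⋙ dkfToCoalg ≅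
          dualCoalgebra (ξ normalAx).hom)) := by
  exact ⟨stoneDuals, ufNAxIso, clopen_mem_ufNAxIso,
    fun Ax => isEquivalence_dualCoalgebra (ufNAxIso Ax),
    ⟨isCatIso_algToNA_empty, isCatIso_coalgToDNF_empty, isEquivalence_dosenDual, ⟨dosenIso⟩⟩,
    ⟨isCatIso_algToMA, isCatIso_dkfToCoalg, isEquivalence_jonssonTarskiDual, ⟨jonssonTarskiIso⟩⟩⟩
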